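/- Let $0<q<1$ and let $\mathcal U_q(\mathfrak{su}(3))$ be the unital associative complex algebra generated by $E_i,F_i,K_i^{\pm1}$ ($i=1,2$) subject to: the $K_i^{\pm1}$ commute, $K_iK_i^{-1}=1=K_i^{-1}K_i$, and $$K_iE_j=q^{a_{ij}}E_jK_i,\qquad K_iF_j=q^{-a_{ij}}F_jK_i,\qquad [E_i,F_j]=\delta_{ij}\frac{K_i-K_i^{-1}}{q-q^{-1}},$$ where $a_{11}=a_{22}=2$, $a_{12}=a_{21}=-1$, together with, for $i\ne j$, the relations $E_i^2E_j-(q+q^{-1})E_iE_jE_i+E_jE_i^2=0$ and $F_i^2F_j-(q+q^{-1})F_iF_jF_i+F_jF_i^2=0$. For $c_1,c_2\in\mathbb C^\times$ let $\mathcal B\subset\mathcal U_q(\mathfrak{su}(3))$ be the (right coideal) subalgebra generated by $$K^{\pm1}=(K_1K_2^{-1})^{\pm1},\qquad B_1=F_1-c_1E_2K_1^{-1},\qquad B_2=F_2-c_2E_1K_2^{-1}.$$ For $\kappa\in\mathbb C^\times$ and $n\in\mathbb N=\{0,1,2,\dots\}$, let $W_{(\kappa,n)}$ denote an irreducible $\mathcal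 B$-module of dimension $n+1$ and highest weight $\kappa$; the latter means that there is a nonzero vector $w_0$ with $B_1w_0=0$ and $Kw_0=\kappa w_0$, and that $q^{-3}\kappa$ is not an eigenvalue of $K$. **Theorem.** Let $\lambda_1,\lambda_2\in\mathbb N$ and let $V_\lambda$ be a finite-dimensional irreducible $\mathcal U_q(\mathfrak{su}(3))$-module of highest weight $\lambda=\lambda_1\varpi_1+\lambda_2\varpi_2$, that is, containing a nonzero vector $v_\lambda$ with $E_iv_\lambda=0$ and $K_iv_\lambda=q^{\lambda_i}v_\lambda$ for $i=1,2$. Assume that $$c_2c_1^{-1}\ne-q^{2\lambda_1+2\lambda_2+1-m}\qquad\text{for all }m\in\mathbb N .$$ Then, as a $\mathcal B$-module, $V_\lambda$ is the direct sum of irreducible submodules $$V_\lambda=\bigoplus_{i=0}^{\lambda_1}\bigoplus_{x=0}^{\lambda_2}W_{(\kappa,n)},\qquad(\kappa,n)=(q^{\lambda_1-\lambda_2-3i},\,i+x),$$ and this decomposition is multiplicity free: the summands belonging to different $(i,x)$ are not isomorphic. -/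

import Mathlib

namespace QuantumSU3

/-- The generators `E i`, `F i`, `K i` and `K i`⁻¹ (written `Kinv i`), where `i = 0, 1`
stands for the index `1, 2` of the simple roots. -/
inductive Gen : Type
  | E (i : Fin 2)
  | F (i : Fin 2)
  | K (i : Fin 2)
  | Kinv (i : Fin 2)

/-- The entries `(αᵢ, αⱼ)` of the Cartan matrix of `sl(3)`. -/
def cartan (i j : Fin 2) : ℤ := if i = j then 2 else -1

/-- A generator, as an element of the free algebra. -/
def gen (g : Gen) : FreeAlgebra ℂ Gen := FreeAlgebra.ι ℂ g

/-- The defining relations of the quantised universal enveloping algebra. -/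
inductive Rel (q : ℂ) : FreeAlgebra ℂ Gen → FreeAlgebra ℂ Gen → Prop
  | K_comm (i j : Fin 2) : Rel q (gen (.K i) * gen (.K j)) (gen (.K j) * gen (.K i))
  | Kinv_comm (i j : Fin 2) :
      Rel q (gen (.Kinv i) * gen (.Kinv j)) (gen (.Kinv j) * gen (.Kinv i))
  | K_Kinv_comm (i j : Fin 2) :
      Rel q (gen (.K i) * gen (.Kinv j)) (gen (.Kinv j) * gen (.K i))
  | K_mul_Kinv (i : Fin 2) : Rel q (gen (.K i) * gen (.Kinv i)) 1
  | Kinv_mul_K (i : Fin 2) : Rel q (gen (.Kinv i) * gen (.K i)) 1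
  | K_E (i j : Fin 2) :
      Rel q (gen (.K i) * gen (.E j)) (q ^ cartan i j • (gen (.E j) * gen (.K i)))
  | K_F (i j : Fin 2) :
      Rel q (gen (.K i) * gen (.F j)) (q ^ (-cartan i j) • (gen (.F j) * gen (.K i)))
  | E_F_same (i : Fin 2) :
      Rel q (gen (.E i) * gen (.F i) - gen (.F i) * gen (.E i))
        ((q - q⁻¹)⁻¹ • (gen (.K i) - gen (.Kinv i)))
  | E_F_ne (i j : Fin 2) (h : i ≠ j) :
      Rel q (gen (.E i) * gen (.F j) - gen (.F j) * gen (.E i)) 0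
  | serre_E (i j : Fin 2) (h : i ≠ j) :
      Rel q (gen (.E i) ^ 2 * gen (.E j)
        - (q + q⁻¹) • (gen (.E i) * gen (.E j) * gen (.E i))
        + gen (.E j) * gen (.E i) ^ 2) 0
  | serre_F (i j : Fin 2) (h : i ≠ j) :
      Rel q (gen (.F i) ^ 2 * gen (.F j)
        - (q + q⁻¹) • (gen (.F i) * gen (.F j) * gen (.F i))
        + gen (.F j) * gen (.F i) ^ 2) 0

/-- The quantised universal enveloping algebra `U_q(su(3))`: the unital associative complex
algebra given by the generators `Gen` and the relations `Rel q`. -/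
def Uq (q : ℂ) : Type := RingQuot (Rel q)

noncomputable instance (q : ℂ) : Ring (Uq q) := inferInstanceAs (Ring (RingQuot (Rel q)))

noncomputable instance (q : ℂ) : Algebra ℂ (Uq q) :=
  inferInstanceAs (Algebra ℂ (RingQuot (Rel q)))

/-- The canonical surjection from the free algebra onto `U_q(su(3))`. -/
noncomputable def Uq.mk (q : ℂ) : FreeAlgebra ℂ Gen →ₐ[ℂ] Uq q := RingQuot.mkAlgHom ℂ (Rel q)

/-- The class of a generator in `U_q(su(3))`. -/
noncomputable def Uq.of (q : ℂ) (g : Gen) : Uq q := Uq.mk q (gen g)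

/-- `E₁, E₂` are `E q 0, E q 1`. -/
noncomputable def E (q : ℂ) (i : Fin 2) : Uq q := Uq.of q (.E i)

/-- `F₁, F₂` are `F q 0, F q 1`. -/
noncomputable def F (q : ℂ) (i : Fin 2) : Uq q := Uq.of q (.F i)

/-- `K₁, K₂` are `K q 0, K q 1`. -/
noncomputable def K (q : ℂ) (i : Fin 2) : Uq q := Uq.of q (.K i)

/-- `K₁⁻¹, K₂⁻¹` are `Kinv q 0, Kinv q 1`. -/
noncomputable def Kinv (q : ℂ) (i : Fin 2) : Uq q := Uq.of q (.Kinv i)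

/-- `v` is a highest weight vector of weight `l₁ ϖ₁ + l₂ ϖ₂`, the weight being given by its
coordinates `l 0 = l₁` and `l 1 = l₂`. -/
structure IsHighestWeightVector (q : ℂ) (l : Fin 2 → ℕ) {V : Type*} [AddCommGroup V]
    [Module ℂ V] [Module (Uq q) V] (v : V) : Prop where
  ne_zero : v ≠ 0
  E_smul : ∀ i, E q i • v = 0
  K_smul : ∀ i, K q i • v = (q ^ l i) • v

/-- `K₁ K₂⁻¹`. -/
noncomputable def elemK (q : ℂ) : Uq q := K q 0 * Kinv q 1

/-- `(K₁ K₂⁻¹)⁻¹`, written `K₂ K₁⁻¹`. -/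
noncomputable def elemKinv (q : ℂ) : Uq q := K q 1 * Kinv q 0

/-- `B₁ = F₁ - c₁ E₂ K₁⁻¹`. -/
noncomputable def elemB₁ (q c₁ : ℂ) : Uq q := F q 0 - c₁ • (E q 1 * Kinv q 0)

/-- `B₂ = F₂ - c₂ E₁ K₂⁻¹`. -/
noncomputable def elemB₂ (q c₂ : ℂ) : Uq q := F q 1 - c₂ • (E q 0 * Kinv q 1)

/-- The right coideal subalgebra `𝓑` with parameters `c₁, c₂`: the unital subalgebra of
`U_q(su(3))` generated by `K₁ K₂⁻¹`, its inverse, `B₁` and `B₂`. -/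
noncomputable def coideal (q c₁ c₂ : ℂ) : Subalgebra ℂ (Uq q) :=
  Algebra.adjoin ℂ {elemK q, elemKinv q, elemB₁ q c₁, elemB₂ q c₂}

/-- `K = K₁ K₂⁻¹` as an element of `𝓑`. -/
noncomputable def coidealK (q c₁ c₂ : ℂ) : coideal q c₁ c₂ :=
  ⟨elemK q, Algebra.subset_adjoin (by simp)⟩

/-- `B₁` as an element of `𝓑`. -/
noncomputable def coidealB₁ (q c₁ c₂ : ℂ) : coideal q c₁ c₂ :=
  ⟨elemB₁ q c₁, Algebra.subset_adjoin (by simp)⟩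

/-- The `𝓑`-module `W` has highest weight `κ`: there is a nonzero vector killed by `B₁` on
which `K` acts by `κ`, while `q⁻³ κ` is not an eigenvalue of `K` on `W`. -/
def HasHighestWeight (q c₁ c₂ κ : ℂ) (W : Type*) [AddCommGroup W] [Module ℂ W]
    [Module (coideal q c₁ c₂) W] : Prop :=
  (∃ w : W, w ≠ 0 ∧ coidealB₁ q c₁ c₂ • w = 0 ∧ coidealK q c₁ c₂ • w = κ • w) ∧
    ∀ w : W, coidealK q c₁ c₂ • w = (q ^ (-3 : ℤ) * κ) • w → w = 0

/-- `W` is the irreducible `𝓑`-module `W_(κ,n)`, that is, the irreducible module with highest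
weight `κ` and dimension `n + 1`. -/
structure IsIrrep (q c₁ c₂ κ : ℂ) (n : ℕ) (W : Type*) [AddCommGroup W] [Module ℂ W]
    [Module (coideal q c₁ c₂) W] [IsScalarTower ℂ (coideal q c₁ c₂) W] : Prop where
  simple : IsSimpleModule (coideal q c₁ c₂) W
  finrank_eq : Module.finrank ℂ W = n + 1
  highestWeight : HasHighestWeight q c₁ c₂ κ W

end QuantumSU3

set_option linter.unusedSimpArgs false

/-! The generators of `𝓑` satisfy inhomogeneous q-Serre relations. These say exactly that two
corrected q-commutators, `Z = opZ` and `Y = opY`, q-commute with `B₁` and `B₂`. They commute with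
`K` and with each other, and `B₂B₁` and `B₁B₂` are linear combinations of `Z`, `Y`, `K`, `K⁻¹`.
Hence on a vector of weight `κ` every word in which `B₁` meets `B₂` is controlled by the operators
`opM` at `a = q^(2t)`, which are affine linear in `(Z, Y)`: each `t` gives a line in the `(Z,
Y)`-plane. A common eigenvector at the intersection of the lines `t = r` and `t = -s-1`, lying on no
other relevant line, generates a string of length `r + s + 1`, and a string spans an irreducible
module.

On the highest weight vector `v` the powers of `B_i` agree with those of `F_i`, so `B₁^(λ₁+1)` and
`B₂^(λ₂+1)` kill `v`. Therefore the product of the lines `t = 0, …, λ₁` kills `v`, and so does that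
of `t = -1, …, -λ₂-1`. Omitting one line from each family yields common eigenvectors, one for each
of the `(λ₁+1)(λ₂+1)` intersection points. The condition on `c₂/c₁` says that no further line of the
two families passes through such a point (`genericity`), and a dimension count (`mem_span_omitProd`)
puts `v` in their span.

The eigenvectors are nonzero by a leading-term argument. Modulo shorter words in the `F_i` one may
set `c₁ = c₂ = 0`; then all lines pass through one point, and nonvanishing reduces to that of the
lowest weight vector (`lowest_ne_zero`).

Finally `v` generates `V` over `𝓑`, since `B_i` is `F_i` plus a term that lowers word length, so the
strings span `V`. They are pairwise non-isomorphic simple modules, hence independent. -/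

namespace QuantumSU3

/-! ### Representations of the quantised enveloping algebra. -/

/-- Operators `e i, f i, k i, ki i` in a complex algebra that satisfy the relations of the
generators of `U_q(su(3))`. -/
structure IsRepr (q : ℂ) {A : Type*} [Ring A] [Algebra ℂ A] (e f k ki : Fin 2 → A) : Prop where
  k_comm : ∀ i j, k i * k j = k j * k i
  ki_comm : ∀ i j, ki i * ki j = ki j * ki i
  k_ki_comm : ∀ i j, k i * ki j = ki j * k i
  k_mul_ki : ∀ i, k i * ki i = 1
  k_e_same : ∀ i, k i * e i = q ^ 2 • (e i * k i)
  k_e_ne : ∀ i j, i ≠ j → k i * e j = q⁻¹ • (e j * k i)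
  k_f_same : ∀ i, k i * f i = (q ^ 2)⁻¹ • (f i * k i)
  k_f_ne : ∀ i j, i ≠ j → k i * f j = q • (f j * k i)
  e_f_same : ∀ i, e i * f i = f i * e i + (q - q⁻¹)⁻¹ • (k i - ki i)
  e_f_ne : ∀ i j, i ≠ j → e i * f j = f j * e i
  serre_e : ∀ i j, i ≠ j →
    e i ^ 2 * e j - (q + q⁻¹) • (e i * e j * e i) + e j * e i ^ 2 = 0
  serre_f : ∀ i j, i ≠ j →
    f i ^ 2 * f j - (q + q⁻¹) • (f i * f j * f i) + f j * f i ^ 2 = 0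

theorem rel_eq {q : ℂ} {x y : FreeAlgebra ℂ Gen} (h : Rel q x y) : Uq.mk q x = Uq.mk q y :=
  RingQuot.mkAlgHom_rel ℂ h

theorem isRepr_gen (q : ℂ) : IsRepr q (E q) (F q) (K q) (Kinv q) where
  k_comm i j := by
    have := rel_eq (Rel.K_comm (q := q) i j)
    simp only [map_mul, map_one] at this
    exact this
  ki_comm i j := by
    have := rel_eq (Rel.Kinv_comm (q := q) i j)
    simp only [map_mul, map_one] at this
    exact this
  k_ki_comm i j := by
    have := rel_eq (Rel.K_Kinv_comm (q := q) i j)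
    simp only [map_mul, map_one] at this
    exact this
  k_mul_ki i := by
    have := rel_eq (Rel.K_mul_Kinv (q := q) i)
    simp only [map_mul, map_one] at this
    exact this
  k_e_same i := by
    have := rel_eq (Rel.K_E (q := q) i i)
    simp only [cartan, if_true, map_mul, map_smul] at this
    exact_mod_cast this
  k_e_ne i j h := by
    have := rel_eq (Rel.K_E (q := q) i j)
    simp only [cartan, if_neg h, map_mul, map_smul, zpow_neg_one] at this
    exact this
  k_f_same i := by
    have := rel_eq (Rel.K_F (q := q) i i)
    simp only [cartan, if_true, map_mul, map_smul, zpow_neg] at this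
    exact_mod_cast this
  k_f_ne i j h := by
    have := rel_eq (Rel.K_F (q := q) i j)
    simp only [cartan, if_neg h, map_mul, map_smul, neg_neg, zpow_one] at this
    exact this
  e_f_same i := by
    have := rel_eq (Rel.E_F_same (q := q) i)
    simp only [map_mul, map_smul, map_sub] at this
    exact (sub_eq_iff_eq_add'.1 this)
  e_f_ne i j h := by
    have := rel_eq (Rel.E_F_ne (q := q) i j h)
    simp only [map_mul, map_sub, map_zero] at this
    exact sub_eq_zero.1 this
  serre_e i j h := by
    have := rel_eq (Rel.serre_E (q := q) i j h)
    simp only [map_mul, map_sub, map_zero, map_add, map_pow, map_smul] at this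
    exact this
  serre_f i j h := by
    have := rel_eq (Rel.serre_F (q := q) i j h)
    simp only [map_mul, map_sub, map_zero, map_add, map_pow, map_smul] at this
    exact this

theorem IsRepr.map {q : ℂ} {A B : Type*} [Ring A] [Algebra ℂ A] [Ring B] [Algebra ℂ B]
    {e f k ki : Fin 2 → A} (h : IsRepr q e f k ki) (φ : A →ₐ[ℂ] B) :
    IsRepr q (fun i => φ (e i)) (fun i => φ (f i)) (fun i => φ (k i)) (fun i => φ (ki i)) where
  k_comm i j := by simp only [← map_mul, h.k_comm i j]
  ki_comm i j := by simp only [← map_mul, h.ki_comm i j]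
  k_ki_comm i j := by simp only [← map_mul, h.k_ki_comm i j]
  k_mul_ki i := by simp only [← map_mul, h.k_mul_ki i, map_one]
  k_e_same i := by simp only [← map_mul, h.k_e_same i, map_smul]
  k_e_ne i j hij := by simp only [← map_mul, h.k_e_ne i j hij, map_smul]
  k_f_same i := by simp only [← map_mul, h.k_f_same i, map_smul]
  k_f_ne i j hij := by simp only [← map_mul, h.k_f_ne i j hij, map_smul]
  e_f_same i := by simp only [← map_mul, h.e_f_same i, map_smul, map_sub, map_add]
  e_f_ne i j hij := by simp only [← map_mul, h.e_f_ne i j hij]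
  serre_e i j hij := by
    simpa only [map_mul, map_sub, map_zero, map_add, map_pow, map_smul]
      using congrArg φ (h.serre_e i j hij)
  serre_f i j hij := by
    simpa only [map_mul, map_sub, map_zero, map_add, map_pow, map_smul]
      using congrArg φ (h.serre_f i j hij)

/-! ### Relations between the generators of the coideal subalgebra. -/

section Commutation

variable {A : Type*} [Ring A] [Algebra ℂ A]

theorem mul_scalar_comm_of_inverse {a x : A} {s : ℂ} (hs : s ≠ 0) {b : A} (hab : a * b = 1)
    (hba : b * a = 1) (h : a * x = s • (x * a)) : b * x = s⁻¹ • (x * b) := by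
  have h1 : b * (a * x) * b = s • (b * (x * a) * b) := by rw [h]; simp
  have h2 : b * (a * x) * b = x * b := by rw [← mul_assoc b a x, hba, one_mul]
  have h3 : b * (x * a) * b = b * x := by rw [← mul_assoc b x a, mul_assoc, hab, mul_one]
  rw [← h2, h1, h3, smul_smul, inv_mul_cancel₀ hs, one_smul]

/-- The cubic relation between the two generators of the coideal subalgebra, with `x` and `y`
standing for `B₁ - F₁` and `B₂ - F₂`, and `P` for `K₁⁻¹K₂⁻¹`. -/
theorem serre_perturbed {q : ℂ} (hq : q ≠ 0) (hD : q - q⁻¹ ≠ 0) (c₁ c₂ : ℂ)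
    {F₁ F₂ x y K Ki P : A}
    (hFx : F₁ * x = (q ^ 2)⁻¹ • (x * F₁))
    (hFy : F₁ * y = q • (y * F₁) + (c₂ * (q - q⁻¹)⁻¹) • (K - P))
    (hF₂x : F₂ * x = q • (x * F₂) + (c₁ * (q - q⁻¹)⁻¹) • (Ki - P))
    (hKF : K * F₁ = (q ^ 3)⁻¹ • (F₁ * K)) (hKx : K * x = (q ^ 3)⁻¹ • (x * K))
    (hKiF : Ki * F₁ = q ^ 3 • (F₁ * Ki)) (hKix : Ki * x = q ^ 3 • (x * Ki))
    (hPF : P * F₁ = q • (F₁ * P)) (hPx : P * x = q⁻¹ • (x * P))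
    (hF : F₁ ^ 2 * F₂ - (q + q⁻¹) • (F₁ * F₂ * F₁) + F₂ * F₁ ^ 2 = 0)
    (hx : x ^ 2 * y - (q + q⁻¹) • (x * y * x) + y * x ^ 2 = 0) :
    (F₁ + x) ^ 2 * (F₂ + y) - (q + q⁻¹) • ((F₁ + x) * (F₂ + y) * (F₁ + x))
      + (F₂ + y) * (F₁ + x) ^ 2
      = (q + q⁻¹) • ((F₁ + x) * (((q ^ 2)⁻¹ * c₂) • K + (q * c₁) • Ki)) := by
  -- The Serre relations, oriented as rewriting rules. With the hypotheses they bring every monomial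
  -- to a normal form in which `x`, `y` precede `F₁`, `F₂` and the Cartan elements come last; only
  -- coefficients remain to be compared.
  have hF' : F₂ * (F₁ * F₁) = (q + q⁻¹) • (F₁ * (F₂ * F₁)) - F₁ * (F₁ * F₂) := by
    rw [← sub_eq_zero, ← hF]; simp only [pow_two, mul_assoc]; abel
  have hx' : y * (x * x) = (q + q⁻¹) • (x * (y * x)) - x * (x * y) := by
    rw [← sub_eq_zero, ← hx]; simp only [pow_two, mul_assoc]; abel
  have aux : ∀ {a b c : A}, a * b = c → ∀ z, a * (b * z) = c * z := by
    intro a b c h z; rw [← mul_assoc, h]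
  have hD2 : q ^ 2 - 1 ≠ 0 := by
    intro h; apply hD; field_simp; linear_combination h
  simp only [pow_two, add_mul, mul_add, mul_assoc, hFx, hFy, hF₂x, hKF, hKx, hKiF, hKix, hPF,
    hPx, aux hFx, aux hFy, aux hF₂x, hF', hx', smul_mul_assoc, mul_smul_comm, sub_mul, mul_sub, smul_sub, smul_add,
    smul_smul]
  match_scalars <;> field_simp <;> ring

/-- The relations of the generators `B₁, B₂, K, K⁻¹` of the coideal subalgebra. -/
structure IsCoidealRepr (q c₁ c₂ : ℂ) (b₁ b₂ k ki : A) : Prop where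
  k_mul_ki : k * ki = 1
  ki_mul_k : ki * k = 1
  k_b₁ : k * b₁ = (q ^ 3)⁻¹ • (b₁ * k)
  k_b₂ : k * b₂ = q ^ 3 • (b₂ * k)
  ki_b₁ : ki * b₁ = q ^ 3 • (b₁ * ki)
  ki_b₂ : ki * b₂ = (q ^ 3)⁻¹ • (b₂ * ki)
  serre₁ : b₁ ^ 2 * b₂ - (q + q⁻¹) • (b₁ * b₂ * b₁) + b₂ * b₁ ^ 2
    = (q + q⁻¹) • (b₁ * (((q ^ 2)⁻¹ * c₂) • k + (q * c₁) • ki))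
  serre₂ : b₂ ^ 2 * b₁ - (q + q⁻¹) • (b₂ * b₁ * b₂) + b₁ * b₂ ^ 2
    = (q + q⁻¹) • (b₂ * (((q ^ 2)⁻¹ * c₁) • ki + (q * c₂) • k))

namespace IsRepr

variable {q : ℂ} {e f k ki : Fin 2 → A}

theorem ki_mul_k (h : IsRepr q e f k ki) (i : Fin 2) : ki i * k i = 1 := by
  rw [← h.k_ki_comm, h.k_mul_ki]

theorem ki_e_same (h : IsRepr q e f k ki) (hq : q ≠ 0) (i : Fin 2) :
    ki i * e i = (q ^ 2)⁻¹ • (e i * ki i) :=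
  mul_scalar_comm_of_inverse (pow_ne_zero _ hq) (h.k_mul_ki i) (h.ki_mul_k i) (h.k_e_same i)

theorem ki_f_same (h : IsRepr q e f k ki) (hq : q ≠ 0) (i : Fin 2) :
    ki i * f i = q ^ 2 • (f i * ki i) := by
  simpa using mul_scalar_comm_of_inverse (inv_ne_zero (pow_ne_zero _ hq)) (h.k_mul_ki i)
    (h.ki_mul_k i) (h.k_f_same i)

theorem ki_e_ne (h : IsRepr q e f k ki) (hq : q ≠ 0) (i j : Fin 2) (hij : i ≠ j) :
    ki i * e j = q • (e j * ki i) := by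
  simpa using mul_scalar_comm_of_inverse (inv_ne_zero hq) (h.k_mul_ki i)
    (h.ki_mul_k i) (h.k_e_ne i j hij)

theorem ki_f_ne (h : IsRepr q e f k ki) (hq : q ≠ 0) (i j : Fin 2) (hij : i ≠ j) :
    ki i * f j = q⁻¹ • (f j * ki i) :=
  mul_scalar_comm_of_inverse hq (h.k_mul_ki i) (h.ki_mul_k i) (h.k_f_ne i j hij)

/-- Applies `serre_perturbed` with `x = -c₁ E_j K_i⁻¹` and `y = -c₂ E_i K_j⁻¹`, which inherit a
homogeneous Serre relation from the `E`'s. Keeping `i ≠ j` symbolic yields both cubic relations, by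
exchanging the indices and the parameters. -/
theorem serre_coideal (h : IsRepr q e f k ki) (hq : q ≠ 0) (hD : q - q⁻¹ ≠ 0) (c₁ c₂ : ℂ)
    {i j : Fin 2} (hij : i ≠ j) {b₁ b₂ : A} (hb₁ : b₁ = f i - c₁ • (e j * ki i))
    (hb₂ : b₂ = f j - c₂ • (e i * ki j)) :
    b₁ ^ 2 * b₂ - (q + q⁻¹) • (b₁ * b₂ * b₁) + b₂ * b₁ ^ 2
      = (q + q⁻¹) • (b₁ * (((q ^ 2)⁻¹ * c₂) • (k i * ki j) + (q * c₁) • (k j * ki i))) := by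
  have aux : ∀ {a b c : A}, a * b = c → ∀ z, a * (b * z) = c * z := by
    intro a b c h z; rw [← mul_assoc, h]
  have hji := hij.symm
  have k1 := h.ki_e_same hq
  have k2 := h.ki_f_same hq
  have k3 := h.ki_e_ne hq i j hij
  have k4 := h.ki_f_ne hq i j hij
  have k5 := h.ki_e_ne hq j i hji
  have k6 := h.ki_f_ne hq j i hji
  have l1 := h.k_e_same
  have l2 := h.k_f_same
  have l3 := h.k_e_ne i j hij
  have l4 := h.k_f_ne i j hij
  have l5 := h.k_e_ne j i hji
  have l6 := h.k_f_ne j i hji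
  have m1 := h.e_f_same i
  have m2 := h.e_f_same j
  have m3 := h.e_f_ne i j hij
  have m4 := h.e_f_ne j i hji
  have n1 := h.ki_comm j i
  have n2 := h.k_comm j i
  have n3 := fun a => h.k_ki_comm a i
  have n4 := fun a => h.k_ki_comm a j
  have hD2 : q ^ 2 - 1 ≠ 0 := by
    intro h; apply hD; field_simp; linear_combination h
  have hse : e j * (e j * e i) = (q + q⁻¹) • (e j * (e i * e j)) - e i * (e j * e j) := by
    rw [← sub_eq_zero, ← h.serre_e j i hji]; simp only [pow_two, mul_assoc]; abel
  have hse' : ∀ z, e j * (e j * (e i * z))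
      = (q + q⁻¹) • (e j * (e i * (e j * z))) - e i * (e j * (e j * z)) := by
    intro z
    have := congrArg (· * z) hse
    simpa only [sub_mul, smul_mul_assoc, mul_assoc] using this
  have hx : b₁ = f i + (-c₁) • (e j * ki i) := by rw [hb₁]; module
  have hy : b₂ = f j + (-c₂) • (e i * ki j) := by rw [hb₂]; module
  rw [hx, hy]
  refine serre_perturbed (P := ki i * ki j) hq hD c₁ c₂ ?_ ?_ ?_ ?_ ?_ ?_ ?_ ?_ ?_
    (h.serre_f i j hij) ?_
  all_goals
    simp only [pow_two, mul_assoc, k1, k2, k3, k4, k5, k6, l1, l2, l3, l4, l5, l6, m1, m2, m3,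
      m4, n1, n2, n3, n4, aux (k1 _), aux (k2 _), aux k3, aux k4, aux k5, aux k6, aux (l1 _),
      aux (l2 _), aux l3, aux l4, aux l5, aux l6, aux m1, aux m2, aux m3, aux m4, aux n1,
      aux n2, aux (n3 _), aux (n4 _), smul_mul_assoc, mul_smul_comm, smul_smul, mul_sub,
      sub_mul, mul_add, add_mul, smul_sub, smul_add, hse']
    match_scalars <;> field_simp <;> ring

theorem weight_coideal (h : IsRepr q e f k ki) (hq : q ≠ 0) (c : ℂ) {i j : Fin 2}
    (hij : i ≠ j) :
    k i * ki j * (f i - c • (e j * ki i)) = (q ^ 3)⁻¹ • ((f i - c • (e j * ki i)) * (k i * ki j))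
      ∧ k j * ki i * (f i - c • (e j * ki i))
        = q ^ 3 • ((f i - c • (e j * ki i)) * (k j * ki i)) := by
  have aux : ∀ {a b c : A}, a * b = c → ∀ z, a * (b * z) = c * z := by
    intro a b c h z; rw [← mul_assoc, h]
  constructor <;>
  simp only [mul_assoc, mul_sub, sub_mul, smul_mul_assoc, mul_smul_comm, smul_smul, smul_sub,
    h.k_e_same, h.k_e_ne _ _ hij, h.k_e_ne _ _ hij.symm, h.k_f_same, h.k_f_ne _ _ hij,
    h.k_f_ne _ _ hij.symm, h.ki_e_same hq, h.ki_f_same hq, h.ki_e_ne hq _ _ hij,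
    h.ki_e_ne hq _ _ hij.symm, h.ki_f_ne hq _ _ hij, h.ki_f_ne hq _ _ hij.symm, aux (h.k_e_same _),
    aux (h.k_e_ne _ _ hij), aux (h.k_e_ne _ _ hij.symm), aux (h.k_f_same _),
    aux (h.k_f_ne _ _ hij), aux (h.k_f_ne _ _ hij.symm), aux (h.ki_e_same hq _),
    aux (h.ki_f_same hq _), aux (h.ki_e_ne hq _ _ hij), aux (h.ki_e_ne hq _ _ hij.symm),
    aux (h.ki_f_ne hq _ _ hij), aux (h.ki_f_ne hq _ _ hij.symm), h.ki_comm j i, h.k_comm j i,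
    h.k_ki_comm, aux (h.ki_comm j i), aux (h.k_comm j i), aux (h.k_ki_comm _ _)] <;>
  match_scalars <;> field_simp

theorem isCoidealRepr (h : IsRepr q e f k ki) (hq : q ≠ 0) (hD : q - q⁻¹ ≠ 0) (c₁ c₂ : ℂ) :
    IsCoidealRepr q c₁ c₂ (f 0 - c₁ • (e 1 * ki 0)) (f 1 - c₂ • (e 0 * ki 1)) (k 0 * ki 1)
      (k 1 * ki 0) where
  k_mul_ki := by
    rw [mul_assoc, ← mul_assoc (ki 1), h.ki_mul_k, one_mul, h.k_mul_ki]
  ki_mul_k := by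
    rw [mul_assoc, ← mul_assoc (ki 0), h.ki_mul_k, one_mul, h.k_mul_ki]
  k_b₁ := (h.weight_coideal hq c₁ (by decide)).1
  k_b₂ := (h.weight_coideal hq c₂ (by decide)).2
  ki_b₁ := (h.weight_coideal hq c₁ (by decide)).2
  ki_b₂ := (h.weight_coideal hq c₂ (by decide)).1
  serre₁ := h.serre_coideal hq hD c₁ c₂ (by decide) rfl rfl
  serre₂ := h.serre_coideal hq hD c₂ c₁ (by decide) rfl rfl

end IsRepr

end Commutation
-- The q-commuting elements `Z` and `Y`.
variable {A : Type*} [Ring A] [Algebra ℂ A]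

/-- An element of weight zero that commutes with `K` and `q`-commutes with `B₁` and `B₂`. -/
noncomputable def opZ (q c₁ c₂ : ℂ) (b₁ b₂ k ki : A) : A :=
  b₁ * b₂ - q • (b₂ * b₁) - (q - q⁻¹)⁻¹ • (c₂ • k - ((q + q⁻¹) * c₁) • ki)

/-- An element of weight zero that commutes with `K` and `q⁻¹`-commutes with `B₁` and `B₂`. -/
noncomputable def opY (q c₁ c₂ : ℂ) (b₁ b₂ k ki : A) : A :=
  b₁ * b₂ - q⁻¹ • (b₂ * b₁) - (q⁻¹ * (q - q⁻¹)⁻¹) • (((q + q⁻¹) * c₂) • k - c₁ • ki)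

namespace IsCoidealRepr

variable {q c₁ c₂ : ℂ} {b₁ b₂ k ki : A}

/-- The cubic Serre expression factors as `b₁ X - q⁻¹ X b₁` with `X = b₁b₂ - q b₂b₁`, and likewise
with `q` and `q⁻¹` exchanged. The Cartan terms in `opZ` and `opY` absorb the inhomogeneous
right-hand sides. -/
theorem comm_opZ (h : IsCoidealRepr q c₁ c₂ b₁ b₂ k ki) (hq : q ≠ 0) (hD : q - q⁻¹ ≠ 0) :
    opZ q c₁ c₂ b₁ b₂ k ki * b₁ = q • (b₁ * opZ q c₁ c₂ b₁ b₂ k ki) ∧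
    opZ q c₁ c₂ b₁ b₂ k ki * b₂ = q⁻¹ • (b₂ * opZ q c₁ c₂ b₁ b₂ k ki) ∧
    opY q c₁ c₂ b₁ b₂ k ki * b₁ = q⁻¹ • (b₁ * opY q c₁ c₂ b₁ b₂ k ki) ∧
    opY q c₁ c₂ b₁ b₂ k ki * b₂ = q • (b₂ * opY q c₁ c₂ b₁ b₂ k ki) := by
  have hD2 : q ^ 2 - 1 ≠ 0 := by
    intro h; apply hD; field_simp; linear_combination h
  have s₁ : b₂ * (b₁ * b₁) = (q + q⁻¹) • (b₁ * (b₂ * b₁)) - b₁ * (b₁ * b₂)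
      + (q + q⁻¹) • (b₁ * (((q ^ 2)⁻¹ * c₂) • k + (q * c₁) • ki)) := by
    rw [← h.serre₁]; simp only [pow_two, mul_assoc]; abel
  have s₂ : b₁ * (b₂ * b₂) = (q + q⁻¹) • (b₂ * (b₁ * b₂)) - b₂ * (b₂ * b₁)
      + (q + q⁻¹) • (b₂ * (((q ^ 2)⁻¹ * c₁) • ki + (q * c₂) • k)) := by
    rw [← h.serre₂]; simp only [pow_two, mul_assoc]; abel
  refine ⟨?_, ?_, ?_, ?_⟩ <;>
  simp only [opZ, opY, mul_assoc, sub_mul, mul_sub, mul_add, smul_mul_assoc, mul_smul_comm, smul_sub,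
    smul_add, smul_smul, h.k_b₁, h.k_b₂, h.ki_b₁, h.ki_b₂, s₁, s₂] <;>
  match_scalars <;> field_simp <;> ring

/-- `opZ` and `opY` are two independent combinations of `b₁b₂` and `b₂b₁` up to Cartan terms; this
and the next lemma solve for the two products. -/
theorem b₂_mul_b₁ (hq : q ≠ 0) (hD : q - q⁻¹ ≠ 0) :
    b₂ * b₁ = (q - q⁻¹)⁻¹ • (opY q c₁ c₂ b₁ b₂ k ki - opZ q c₁ c₂ b₁ b₂ k ki
      + (q - q⁻¹)⁻¹ • (((q ^ 2)⁻¹ * c₂) • k + (q * c₁) • ki)) := by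
  have hD2 : q ^ 2 - 1 ≠ 0 := by
    intro h; apply hD; field_simp; linear_combination h
  unfold opZ opY
  match_scalars <;> field_simp <;> ring

theorem b₁_mul_b₂ (hq : q ≠ 0) (hD : q - q⁻¹ ≠ 0) :
    b₁ * b₂ = (q - q⁻¹)⁻¹ • (q • opY q c₁ c₂ b₁ b₂ k ki - q⁻¹ • opZ q c₁ c₂ b₁ b₂ k ki
      + (q - q⁻¹)⁻¹ • ((q * c₂) • k + ((q ^ 2)⁻¹ * c₁) • ki)) := by
  have hD2 : q ^ 2 - 1 ≠ 0 := by
    intro h; apply hD; field_simp; linear_combination h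
  unfold opZ opY
  match_scalars <;> field_simp <;> ring

end IsCoidealRepr
theorem mul_pow_of_mul_eq_smul {A : Type*} [Ring A] [Algebra ℂ A] {a b : A} {s : ℂ}
    (h : a * b = s • (b * a)) (n : ℕ) : a * b ^ n = s ^ n • (b ^ n * a) := by
  induction n with
  | zero => simp
  | succ n ih =>
    rw [pow_succ, ← mul_assoc, ih, smul_mul_assoc, mul_assoc, h, mul_smul_comm, smul_smul,
      ← pow_succ, mul_assoc]

/-- Two commuting elements of an algebra define an action of the polynomials in two variables. -/
theorem exists_algHom_of_commute {A : Type*} [Ring A] [Algebra ℂ A] {z y : A}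
    (h : z * y = y * z) :
    ∃ φ : MvPolynomial (Fin 2) ℂ →ₐ[ℂ] A, φ (.X 0) = z ∧ φ (.X 1) = y := by
  have hc : ∀ a ∈ ({z, y} : Set A), ∀ b ∈ ({z, y} : Set A), a * b = b * a := by
    rintro a (rfl | rfl) b (rfl | rfl) <;> simp [h]
  have := Algebra.isMulCommutative_adjoin ℂ hc
  open scoped IsMulCommutative in
  let z' : Algebra.adjoin ℂ ({z, y} : Set A) := ⟨z, Algebra.subset_adjoin (by simp)⟩
  let y' : Algebra.adjoin ℂ ({z, y} : Set A) := ⟨y, Algebra.subset_adjoin (by simp)⟩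
  refine ⟨(Algebra.adjoin ℂ ({z, y} : Set A)).val.comp (MvPolynomial.aeval ![z', y']), ?_, ?_⟩
  · simp [z']
  · simp [y']

/-! ### Action of the products of `B₁` and `B₂` on weight vectors. -/

section Operators

variable {V : Type*} [AddCommGroup V] [Module ℂ V]

/-- The operator by which, up to a scalar, `B₂ B₁` acts on vectors of weight `κ` (for `a = 1`)
and on their images under the powers of `B₁` and `B₂`. -/
noncomputable def opM (q c₁ c₂ κ : ℂ) (Z Y : Module.End ℂ V) (a : ℂ) : Module.End ℂ V :=
  Y - a • Z + ((q - q⁻¹)⁻¹ * (q * c₁ * κ⁻¹ * a ^ 2 + (q ^ 2)⁻¹ * c₂ * κ * a⁻¹)) • 1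

namespace IsCoidealRepr

variable {q c₁ c₂ κ : ℂ} {b₁ b₂ k ki : Module.End ℂ V}

theorem ki_apply (h : IsCoidealRepr q c₁ c₂ b₁ b₂ k ki) (hκ : κ ≠ 0) {u : V}
    (hu : k u = κ • u) : ki u = κ⁻¹ • u := by
  have h1 : ki (k u) = u := by rw [← Module.End.mul_apply, h.ki_mul_k, Module.End.one_apply]
  rw [hu, map_smul] at h1
  rw [← h1, smul_smul, inv_mul_cancel₀ hκ, one_smul]
  exact congrArg ki h1

theorem k_comm_opZ (h : IsCoidealRepr q c₁ c₂ b₁ b₂ k ki) (hq : q ≠ 0) :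
    k * opZ q c₁ c₂ b₁ b₂ k ki = opZ q c₁ c₂ b₁ b₂ k ki * k ∧
    k * opY q c₁ c₂ b₁ b₂ k ki = opY q c₁ c₂ b₁ b₂ k ki * k := by
  have aux : ∀ {a b c : Module.End ℂ V}, a * b = c → ∀ z, a * (b * z) = c * z := by
    intro a b c h z; rw [← mul_assoc, h]
  constructor <;>
  simp only [opZ, opY, mul_assoc, sub_mul, mul_sub, mul_add, smul_mul_assoc, mul_smul_comm,
    smul_sub, smul_add, smul_smul, h.k_b₁, h.k_b₂, aux h.k_b₁, aux h.k_b₂, h.ki_mul_k,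
    h.k_mul_ki] <;>
  match_scalars <;> field_simp

/-- The factors `q` and `q⁻¹` that `Z` picks up at `b₁` and `b₂` cancel on `b₁b₂` and `b₂b₁`, and
`Z` commutes with `k`, `ki`; these span `Y`. -/
theorem opZ_comm_opY (h : IsCoidealRepr q c₁ c₂ b₁ b₂ k ki) (hq : q ≠ 0) (hD : q - q⁻¹ ≠ 0) :
    opZ q c₁ c₂ b₁ b₂ k ki * opY q c₁ c₂ b₁ b₂ k ki
      = opY q c₁ c₂ b₁ b₂ k ki * opZ q c₁ c₂ b₁ b₂ k ki := by
  obtain ⟨h1, h2, -, -⟩ := h.comm_opZ hq hD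
  obtain ⟨h3, -⟩ := h.k_comm_opZ hq
  have h4 : opZ q c₁ c₂ b₁ b₂ k ki * ki = ki * opZ q c₁ c₂ b₁ b₂ k ki := by
    calc _ = ki * (k * opZ q c₁ c₂ b₁ b₂ k ki) * ki := by
          rw [← mul_assoc ki, h.ki_mul_k, one_mul]
      _ = _ := by rw [h3, mul_assoc, mul_assoc, h.k_mul_ki, mul_one]
  have aux : ∀ {a b c : Module.End ℂ V}, a * b = c → ∀ z, a * (b * z) = c * z := by
    intro a b c h z; rw [← mul_assoc, h]
  generalize opZ q c₁ c₂ b₁ b₂ k ki = Z at *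
  unfold opY
  simp only [mul_assoc, sub_mul, mul_sub, smul_mul_assoc, mul_smul_comm, smul_sub, smul_smul,
    h1, h2, h3, h4, aux h1, aux h2]
  match_scalars <;> field_simp

variable {Z Y : Module.End ℂ V}

/-- Passing `b₁^r` multiplies `Y`, `Z`, `k`, `ki` by `q^(-r)`, `q^r`, `q^(-3r)`, `q^(3r)`. Taking
out `q^(-r)` leaves `1`, `a`, `a⁻¹`, `a²` with `a = q^(2r)`, which is the shape of `opM`. -/
theorem b₂_b₁_apply (h : IsCoidealRepr q c₁ c₂ b₁ b₂ k ki) (hq : q ≠ 0) (hD : q - q⁻¹ ≠ 0)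
    (hκ : κ ≠ 0) (hZ : Z = opZ q c₁ c₂ b₁ b₂ k ki) (hY : Y = opY q c₁ c₂ b₁ b₂ k ki)
    {u : V} (hu : k u = κ • u) (r : ℕ) :
    b₂ ((b₁ ^ (r + 1)) u) = ((q - q⁻¹)⁻¹ * (q ^ r)⁻¹) •
      (b₁ ^ r) (opM q c₁ c₂ κ Z Y (q ^ (2 * (r : ℤ))) u) := by
  obtain ⟨h1, -, h3, -⟩ := h.comm_opZ hq hD
  rw [pow_succ', ← Module.End.mul_apply, ← mul_assoc, b₂_mul_b₁ (b₁ := b₁) (c₁ := c₁) (c₂ := c₂) (k := k)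
    (ki := ki) hq hD, ← hZ, ← hY]
  rw [← hZ] at h1
  rw [← hY] at h3
  simp only [add_mul, sub_mul, smul_mul_assoc, mul_pow_of_mul_eq_smul h1,
    mul_pow_of_mul_eq_smul h3, mul_pow_of_mul_eq_smul h.k_b₁, mul_pow_of_mul_eq_smul h.ki_b₁,
    LinearMap.add_apply, LinearMap.sub_apply, LinearMap.smul_apply, Module.End.mul_apply, hu,
    h.ki_apply hκ hu, opM, Module.End.one_apply, map_add, map_sub, map_smul]
  have e : q ^ (2 * (r : ℤ)) = (q ^ r) ^ 2 := by
    rw [mul_comm, zpow_mul, zpow_natCast]; norm_cast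
  have e2 : (q ^ 3) ^ r = (q ^ r) ^ 3 := by rw [← pow_mul, ← pow_mul, mul_comm]
  rw [e]
  simp only [inv_pow, e2]
  have hr : q ^ r ≠ 0 := pow_ne_zero _ hq
  generalize q ^ r = t at *
  have hD2 : q ^ 2 - 1 ≠ 0 := by
    intro h; apply hD; field_simp; linear_combination h
  match_scalars <;> field_simp
  ring

/-- As before, now passing `b₂^s b₁^r`. The extra `-1` in the exponent comes from the coefficients
`q`, `q⁻¹` of `Y`, `Z` in `b₁b₂`. -/
theorem b₁_b₂_apply (h : IsCoidealRepr q c₁ c₂ b₁ b₂ k ki) (hq : q ≠ 0) (hD : q - q⁻¹ ≠ 0)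
    (hκ : κ ≠ 0) (hZ : Z = opZ q c₁ c₂ b₁ b₂ k ki) (hY : Y = opY q c₁ c₂ b₁ b₂ k ki)
    {u : V} (hu : k u = κ • u) (r s : ℕ) :
    b₁ ((b₂ ^ (s + 1)) ((b₁ ^ r) u)) = ((q - q⁻¹)⁻¹ * (q * q ^ s * (q ^ r)⁻¹)) •
      (b₂ ^ s) ((b₁ ^ r) (opM q c₁ c₂ κ Z Y (q ^ (2 * ((r : ℤ) - s - 1))) u)) := by
  obtain ⟨h1, h2, h3, h4⟩ := h.comm_opZ hq hD
  have e0 : ∀ x : V, b₁ (b₂ x) = (b₁ * b₂) x := fun _ => rfl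
  rw [pow_succ', Module.End.mul_apply, e0, b₁_mul_b₂ (c₁ := c₁) (c₂ := c₂) (k := k)
    (ki := ki) hq hD, ← hZ, ← hY]
  rw [← hZ] at h1 h2
  rw [← hY] at h3 h4
  have ap : ∀ {a b : Module.End ℂ V} {t : ℂ}, a * b = t • (b * a) → ∀ (n : ℕ) (x : V),
      a ((b ^ n) x) = t ^ n • (b ^ n) (a x) := fun hab n x =>
    LinearMap.congr_fun (mul_pow_of_mul_eq_smul hab n) x
  simp only [LinearMap.add_apply, LinearMap.sub_apply, LinearMap.smul_apply, ap h1, ap h2, ap h3,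
    ap h4, ap h.k_b₁, ap h.k_b₂, ap h.ki_b₁, ap h.ki_b₂, hu,
    h.ki_apply hκ hu, opM, Module.End.one_apply, map_add, map_sub, map_smul]
  have e : q ^ (2 * ((r : ℤ) - s - 1)) = (q ^ r * (q ^ s)⁻¹ * q⁻¹) ^ 2 := by
    rw [mul_comm, zpow_mul, zpow_sub₀ hq, zpow_sub₀ hq, zpow_natCast, zpow_natCast, zpow_one]
    norm_cast
  have e2 : ∀ r, (q ^ 3) ^ r = (q ^ r) ^ 3 := fun r => by rw [← pow_mul, ← pow_mul, mul_comm]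
  rw [e]
  simp only [inv_pow, e2]
  have hr : q ^ r ≠ 0 := pow_ne_zero _ hq
  have hs : q ^ s ≠ 0 := pow_ne_zero _ hq
  generalize q ^ r = t at *
  generalize q ^ s = t' at *
  have hD2 : q ^ 2 - 1 ≠ 0 := by
    intro h; apply hD; field_simp; linear_combination h
  match_scalars <;> field_simp
  ring

end IsCoidealRepr
end Operators
-- Two families of lines and the common eigenvectors at their intersections.
section Intersection

open Finset

variable {R : Type*} [CommRing R] [Algebra ℂ R]

/-- The product of all `A t`, `t ≤ l₁`, and all `B t`, `t ≤ l₂`, without the factors `A r`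
and `B s`. -/
def omitProd (A B : ℕ → R) (l₁ l₂ r s : ℕ) : R :=
  (∏ t ∈ (range (l₁ + 1)).erase r, A t) * ∏ t ∈ (range (l₂ + 1)).erase s, B t

variable {V : Type*} [AddCommGroup V] [Module ℂ V] {φ : R →ₐ[ℂ] Module.End ℂ V} {A B : ℕ → R}
  {l₁ l₂ : ℕ} {v : V}

theorem mul_omitProd_left {r : ℕ} (hr : r ≤ l₁) (s : ℕ) :
    A r * omitProd A B l₁ l₂ r s
      = (∏ t ∈ (range (l₂ + 1)).erase s, B t) * ∏ t ∈ range (l₁ + 1), A t := by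
  rw [omitProd, ← mul_assoc, mul_prod_erase _ _ (by simpa using Nat.lt_succ_of_le hr), mul_comm]

theorem mul_omitProd_right {s : ℕ} (hs : s ≤ l₂) (r : ℕ) :
    B s * omitProd A B l₁ l₂ r s
      = (∏ t ∈ (range (l₁ + 1)).erase r, A t) * ∏ t ∈ range (l₂ + 1), B t := by
  rw [omitProd, mul_left_comm, mul_prod_erase _ _ (by simpa using Nat.lt_succ_of_le hs)]

/-- The product omitting `r'` contains the factor `A r`. Writing it through `A r'` and `B s` gives
the product omitting `r`, plus a term containing all the `B t`, which kills `v`. -/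
theorem omitProd_eq_zero_of_left
    (hB : φ (∏ t ∈ range (l₂ + 1), B t) v = 0)
    (hrel : ∀ r r' s, ∃ μ ν : ℂ, A r' = μ • A r + ν • B s)
    {r r' s : ℕ} (hr : r ≤ l₁) (hr' : r' ≤ l₁) (hs : s ≤ l₂)
    (h0 : φ (omitProd A B l₁ l₂ r s) v = 0) : φ (omitProd A B l₁ l₂ r' s) v = 0 := by
  by_cases hrr : r = r'
  · rwa [← hrr]
  obtain ⟨μ, ν, h⟩ := hrel r' r s
  have key : omitProd A B l₁ l₂ r' s = μ • omitProd A B l₁ l₂ r s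
      + (ν • ∏ t ∈ ((range (l₁ + 1)).erase r').erase r, A t) * ∏ t ∈ range (l₂ + 1), B t := by
    have h1 : ∏ t ∈ (range (l₁ + 1)).erase r', A t
        = A r * ∏ t ∈ ((range (l₁ + 1)).erase r').erase r, A t := by
      rw [mul_prod_erase]
      simp only [mem_erase, mem_range]; omega
    have h2 : ∏ t ∈ (range (l₁ + 1)).erase r, A t
        = A r' * ∏ t ∈ ((range (l₁ + 1)).erase r').erase r, A t := by
      rw [erase_right_comm, mul_prod_erase]
      simp only [mem_erase, mem_range]; omega
    have h3 : ∏ t ∈ range (l₂ + 1), B t = B s * ∏ t ∈ (range (l₂ + 1)).erase s, B t := by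
      rw [mul_prod_erase]; simp only [mem_range]; omega
    rw [omitProd, omitProd, h1, h2, h3, h]
    simp only [Algebra.smul_def]
    ring
  rw [key, map_add, LinearMap.add_apply, map_smul, LinearMap.smul_apply, h0, map_mul,
    Module.End.mul_apply, hB]
  simp

theorem omitProd_comm (r s : ℕ) : omitProd A B l₁ l₂ r s = omitProd B A l₂ l₁ s r :=
  mul_comm _ _

/-- Moving the omitted indices one at a time to `(l₁, l₂)` reduces all cases to the product over
`range l₁` and `range l₂`. -/
theorem omitProd_ne_zero
    (hA : φ (∏ t ∈ range (l₁ + 1), A t) v = 0) (hB : φ (∏ t ∈ range (l₂ + 1), B t) v = 0)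
    (hrelA : ∀ r r' s, ∃ μ ν : ℂ, A r' = μ • A r + ν • B s)
    (hrelB : ∀ s s' r, ∃ μ ν : ℂ, B s' = μ • B s + ν • A r)
    (h0 : φ ((∏ t ∈ range l₁, A t) * ∏ t ∈ range l₂, B t) v ≠ 0)
    {r s : ℕ} (hr : r ≤ l₁) (hs : s ≤ l₂) : φ (omitProd A B l₁ l₂ r s) v ≠ 0 := by
  intro h
  apply h0
  have e : ∀ n, (range (n + 1)).erase n = range n := fun n => by
    ext; simp only [mem_erase, mem_range]; omega
  have h1 := omitProd_eq_zero_of_left hB hrelA hr le_rfl hs h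
  rw [omitProd_comm] at h1
  have h2 := omitProd_eq_zero_of_left hA hrelB hs le_rfl le_rfl h1
  rwa [omitProd_comm, omitProd, e, e] at h2

theorem apply_omitProd_left (hA : φ (∏ t ∈ range (l₁ + 1), A t) v = 0) {r : ℕ} (hr : r ≤ l₁)
    (s : ℕ) : φ (A r) (φ (omitProd A B l₁ l₂ r s) v) = 0 := by
  rw [← Module.End.mul_apply, ← map_mul, mul_omitProd_left hr, map_mul, Module.End.mul_apply, hA,
    map_zero]

theorem apply_omitProd_right (hB : φ (∏ t ∈ range (l₂ + 1), B t) v = 0) {s : ℕ} (hs : s ≤ l₂)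
    (r : ℕ) : φ (B s) (φ (omitProd A B l₁ l₂ r s) v) = 0 := by
  rw [← Module.End.mul_apply, ← map_mul, mul_omitProd_right hs, map_mul, Module.End.mul_apply,
    hB, map_zero]

theorem prod_apply_eigenvector {ι : Type*} (S : Finset ι) (C : ι → R) {u : V}
    (h : ∀ t ∈ S, ∃ γ : ℂ, γ ≠ 0 ∧ φ (C t) u = γ • u) :
    ∃ γ : ℂ, γ ≠ 0 ∧ φ (∏ t ∈ S, C t) u = γ • u := by
  classical
  induction S using Finset.induction_on with
  | empty => exact ⟨1, one_ne_zero, by simp⟩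
  | insert a S ha ih =>
    obtain ⟨γ, hγ, h1⟩ := ih fun t ht => h t (mem_insert_of_mem ht)
    obtain ⟨δ, hδ, h2⟩ := h a (mem_insert_self a S)
    refine ⟨γ * δ, mul_ne_zero hγ hδ, ?_⟩
    rw [prod_insert ha, map_mul, Module.End.mul_apply, h1, map_smul, h2, smul_smul]

/-- If `v` is killed by the product of the lines `A r` and by the product of the lines `B s`,
which meet transversally in distinct points, then `v` is a sum of common eigenvectors. -/
theorem mem_span_omitProd
    (hA : φ (∏ t ∈ range (l₁ + 1), A t) v = 0) (hB : φ (∏ t ∈ range (l₂ + 1), B t) v = 0)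
    (hrelA : ∀ r s t, r ≤ l₁ → s ≤ l₂ → t ≤ l₁ →
      ∃ α β γ : ℂ, A t = α • A r + β • B s + γ • 1 ∧ (t ≠ r → γ ≠ 0))
    (hrelB : ∀ r s t, r ≤ l₁ → s ≤ l₂ → t ≤ l₂ →
      ∃ α β γ : ℂ, B t = α • A r + β • B s + γ • 1 ∧ (t ≠ s → γ ≠ 0))
    (hne : ∀ r s, r ≤ l₁ → s ≤ l₂ → φ (omitProd A B l₁ l₂ r s) v ≠ 0) :
    v ∈ Submodule.span ℂ (Set.range fun p : Fin (l₁ + 1) × Fin (l₂ + 1) =>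
      φ (omitProd A B l₁ l₂ p.1 p.2) v) := by
  set u : Fin (l₁ + 1) × Fin (l₂ + 1) → V := fun p => φ (omitProd A B l₁ l₂ p.1 p.2) v with hu
  -- The partial products `w` are equal in number to the eigenvectors `u`, and `v = w (0, 0)`. Their
  -- span contains the independent family `u`, so the two spans coincide.
  set w : Fin (l₁ + 1) × Fin (l₂ + 1) → V := fun p =>
    φ ((∏ t ∈ range p.1, A t) * ∏ t ∈ range p.2, B t) v with hw
  have uA : ∀ p, φ (A p.1) (u p) = 0 := fun p =>
    apply_omitProd_left hA (Nat.lt_succ_iff.1 p.1.2) _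
  have uB : ∀ p, φ (B p.2) (u p) = 0 := fun p =>
    apply_omitProd_right hB (Nat.lt_succ_iff.1 p.2.2) _
  have une : ∀ p, u p ≠ 0 := fun p => hne _ _ (Nat.lt_succ_iff.1 p.1.2) (Nat.lt_succ_iff.1 p.2.2)
  -- If the points differ, the product omitting the lines through `p` still contains a line through
  -- `p'`, which kills `u p'`.
  have hoff : ∀ p p', p ≠ p' → φ (omitProd A B l₁ l₂ p.1 p.2) (u p') = 0 := by
    intro p p' hpp
    by_cases h1 : p.1 = p'.1
    · have h2 : p'.2 ≠ p.2 := fun h => hpp (Prod.ext h1 h.symm)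
      have : (p'.2 : ℕ) ∈ (range (l₂ + 1)).erase (p.2 : ℕ) := by
        simp only [mem_erase, mem_range]
        exact ⟨fun h => h2 (Fin.ext h), p'.2.2⟩
      rw [omitProd, ← prod_erase_mul _ _ this, map_mul, map_mul, Module.End.mul_apply,
        Module.End.mul_apply, uB, map_zero, map_zero]
    · have : (p'.1 : ℕ) ∈ (range (l₁ + 1)).erase (p.1 : ℕ) := by
        simp only [mem_erase, mem_range]
        exact ⟨fun h => h1 (Fin.ext h.symm), p'.1.2⟩
      rw [omitProd, mul_comm, ← prod_erase_mul _ _ this, map_mul, map_mul, Module.End.mul_apply,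
        Module.End.mul_apply, uA, map_zero, map_zero]
  have hdiag : ∀ p, ∃ γ : ℂ, γ ≠ 0 ∧ φ (omitProd A B l₁ l₂ p.1 p.2) (u p) = γ • u p := by
    intro p
    obtain ⟨γ, hγ, h1⟩ := prod_apply_eigenvector (φ := φ) (u := u p) ((range (l₁ + 1)).erase (p.1 : ℕ)) A
      fun t ht => by
        obtain ⟨α, β, γ, h, hγ⟩ := hrelA p.1 p.2 t (Nat.lt_succ_iff.1 p.1.2)
          (Nat.lt_succ_iff.1 p.2.2) (by simp only [mem_erase, mem_range] at ht; omega)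
        refine ⟨γ, hγ (mem_erase.1 ht).1, ?_⟩
        rw [h]; simp [uA, uB]
    obtain ⟨δ, hδ, h2⟩ := prod_apply_eigenvector (φ := φ) (u := u p) ((range (l₂ + 1)).erase (p.2 : ℕ)) B
      fun t ht => by
        obtain ⟨α, β, γ, h, hγ⟩ := hrelB p.1 p.2 t (Nat.lt_succ_iff.1 p.1.2)
          (Nat.lt_succ_iff.1 p.2.2) (by simp only [mem_erase, mem_range] at ht; omega)
        refine ⟨γ, hγ (mem_erase.1 ht).1, ?_⟩
        rw [h]; simp [uA, uB]
    exact ⟨δ * γ, mul_ne_zero hδ hγ, by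
      rw [omitProd, map_mul, Module.End.mul_apply, h2, map_smul, h1, smul_smul]⟩
  have hli : LinearIndependent ℂ u := by
    rw [Fintype.linearIndependent_iff]
    intro g hg p
    have h1 := congrArg (φ (omitProd A B l₁ l₂ p.1 p.2)) hg
    obtain ⟨γ, hγ, h2⟩ := hdiag p
    rw [map_sum, map_zero, Finset.sum_eq_single p, map_smul, h2, smul_smul] at h1
    · rcases smul_eq_zero.1 h1 with h | h
      · exact (mul_eq_zero.1 h).resolve_right hγ
      · exact absurd h (une p)
    · intro p' _ hp'
      rw [map_smul, hoff p p' hp'.symm, smul_zero]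
    · simp
  -- The indices run one step past the range of `w`, where the vector is zero; multiplication by a
  -- line then never leaves the span.
  have hwmem : ∀ r s, r ≤ l₁ + 1 → s ≤ l₂ + 1 →
      φ ((∏ t ∈ range r, A t) * ∏ t ∈ range s, B t) v ∈ Submodule.span ℂ (Set.range w) := by
    intro r s hr hs
    rcases hr.lt_or_eq with hr | rfl
    · rcases hs.lt_or_eq with hs | rfl
      · exact Submodule.subset_span ⟨(⟨r, hr⟩, ⟨s, hs⟩), rfl⟩
      · rw [map_mul, Module.End.mul_apply, hB, map_zero]; exact zero_mem _
    · rw [mul_comm, map_mul, Module.End.mul_apply, hA, map_zero]; exact zero_mem _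
  have hstep : ∀ (c : R), (∀ r s, r ≤ l₁ → s ≤ l₂ → ∃ α β γ : ℂ,
      c = α • A r + β • B s + γ • 1) → ∀ x ∈ Submodule.span ℂ (Set.range w),
      φ c x ∈ Submodule.span ℂ (Set.range w) := by
    intro c hc x hx
    induction hx using Submodule.span_induction with
    | zero => rw [map_zero]; exact zero_mem _
    | add x y _ _ hx hy => rw [map_add]; exact add_mem hx hy
    | smul a x _ hx => rw [map_smul]; exact Submodule.smul_mem _ _ hx
    | mem x hx =>
      obtain ⟨⟨r, s⟩, rfl⟩ := hx
      obtain ⟨α, β, γ, h⟩ := hc r s (Nat.lt_succ_iff.1 r.2) (Nat.lt_succ_iff.1 s.2)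
      -- Expanding `c` in the two lines that come next after `w (r, s)` gives neighbouring partial
      -- products.
      have e : φ c (w (r, s)) = α • φ ((∏ t ∈ range (r + 1), A t) * ∏ t ∈ range s, B t) v
          + β • φ ((∏ t ∈ range r, A t) * ∏ t ∈ range (s + 1), B t) v
          + γ • φ ((∏ t ∈ range r, A t) * ∏ t ∈ range s, B t) v := by
        rw [← LinearMap.smul_apply, ← LinearMap.smul_apply, ← LinearMap.smul_apply, ← map_smul,
          ← map_smul, ← map_smul, ← LinearMap.add_apply, ← LinearMap.add_apply, ← map_add,
          ← map_add, hw, ← Module.End.mul_apply, ← map_mul, h, prod_range_succ, prod_range_succ]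
        congr 2
        simp only [Algebra.smul_def]
        ring
      rw [e]
      exact add_mem (add_mem (Submodule.smul_mem _ _ (hwmem _ _ r.2 s.2.le))
        (Submodule.smul_mem _ _ (hwmem _ _ r.2.le s.2))) (Submodule.smul_mem _ _
        (hwmem _ _ r.2.le s.2.le))
  have hprod : ∀ {ι : Type} (S : Finset ι) (C : ι → R), (∀ t ∈ S, ∀ r s, r ≤ l₁ → s ≤ l₂ →
      ∃ α β γ : ℂ, C t = α • A r + β • B s + γ • 1) → ∀ x ∈ Submodule.span ℂ (Set.range w),
      φ (∏ t ∈ S, C t) x ∈ Submodule.span ℂ (Set.range w) := by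
    classical
    intro ι S C hC
    induction S using Finset.induction_on with
    | empty => intro x hx; simpa using hx
    | insert a S ha ih =>
      intro x hx
      rw [prod_insert ha, map_mul, Module.End.mul_apply]
      exact hstep _ (hC a (mem_insert_self a S)) _
        (ih (fun t ht => hC t (mem_insert_of_mem ht)) x hx)
  have hvw : v ∈ Submodule.span ℂ (Set.range w) := by
    simpa using hwmem 0 0 (Nat.zero_le _) (Nat.zero_le _)
  have huw : Submodule.span ℂ (Set.range u) ≤ Submodule.span ℂ (Set.range w) := by
    rw [Submodule.span_le]
    rintro _ ⟨p, rfl⟩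
    simp only [hu, omitProd, map_mul, Module.End.mul_apply]
    refine hprod _ A ?_ _ (hprod _ B ?_ _ hvw)
    · intro t ht r s hr hs
      obtain ⟨α, β, γ, h, -⟩ := hrelA r s t hr hs
        (by simp only [mem_erase, mem_range] at ht; omega)
      exact ⟨α, β, γ, h⟩
    · intro t ht r s hr hs
      obtain ⟨α, β, γ, h, -⟩ := hrelB r s t hr hs
        (by simp only [mem_erase, mem_range] at ht; omega)
      exact ⟨α, β, γ, h⟩
  have : FiniteDimensional ℂ (Submodule.span ℂ (Set.range w)) :=
    FiniteDimensional.span_of_finite ℂ (Set.finite_range w)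
  have heq := Submodule.eq_of_le_of_finrank_le huw
    ((finrank_range_le_card w).trans (finrank_span_eq_card hli).ge)
  rw [heq]
  exact hvw

end Intersection
-- The lines attached to the coideal subalgebra, and strings.
section Lines

variable {V : Type*} [AddCommGroup V] [Module ℂ V]

/-- The polynomial in `Z` and `Y` that acts as `opM`. -/
noncomputable def polyM (q c₁ c₂ κ a : ℂ) : MvPolynomial (Fin 2) ℂ :=
  .X 1 - a • .X 0 + ((q - q⁻¹)⁻¹ * (q * c₁ * κ⁻¹ * a ^ 2 + (q ^ 2)⁻¹ * c₂ * κ * a⁻¹)) • 1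

theorem map_polyM {q c₁ c₂ κ a : ℂ} {Z Y : Module.End ℂ V}
    {φ : MvPolynomial (Fin 2) ℂ →ₐ[ℂ] Module.End ℂ V} (hZ : φ (.X 0) = Z) (hY : φ (.X 1) = Y) :
    φ (polyM q c₁ c₂ κ a) = opM q c₁ c₂ κ Z Y a := by
  rw [polyM, opM, map_add, map_sub, map_smul, map_smul, map_one, hZ, hY]

/-- The coefficients of `Y` and `Z` are affine in `a`, so linear interpolation at `a'` and `b'`
reproduces them. Only `a²` and `a⁻¹` leave a remainder, a scalar divisible by `(a - a')(a - b')`. It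
vanishes for `c₁ = c₂ = 0`, where the lines form a pencil. -/
theorem polyM_interpolate (q c₁ c₂ κ : ℂ) {a a' b' : ℂ} (ha : a ≠ 0) (ha' : a' ≠ 0)
    (hb' : b' ≠ 0) (hab : a' ≠ b') :
    polyM q c₁ c₂ κ a = ((a - b') / (a' - b')) • polyM q c₁ c₂ κ a'
      + ((a - a') / (b' - a')) • polyM q c₁ c₂ κ b'
      + ((q - q⁻¹)⁻¹ * ((a - a') * (a - b'))
        * (q * c₁ * κ⁻¹ + (q ^ 2)⁻¹ * c₂ * κ / (a * a' * b'))) • 1 := by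
  have h1 : a' - b' ≠ 0 := sub_ne_zero.2 hab
  have h2 : b' - a' ≠ 0 := sub_ne_zero.2 hab.symm
  have h3 : b' - a' = -(a' - b') := by ring
  unfold polyM
  rw [h3]
  generalize (q - q⁻¹)⁻¹ = d
  generalize (q ^ 2)⁻¹ * c₂ * κ = e₀
  generalize q * c₁ * κ⁻¹ = e₃
  match_scalars <;> field_simp <;> ring

theorem mem_of_stable {φ : MvPolynomial (Fin 2) ℂ →ₐ[ℂ] Module.End ℂ V} {S : Submodule ℂ V}
    (h0 : ∀ x ∈ S, φ (.X 0) x ∈ S) (h1 : ∀ x ∈ S, φ (.X 1) x ∈ S)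
    (p : MvPolynomial (Fin 2) ℂ) : ∀ x ∈ S, φ p x ∈ S := by
  induction p using MvPolynomial.induction_on with
  | C a =>
    intro x hx
    rw [← MvPolynomial.algebraMap_eq, AlgHom.commutes, Module.algebraMap_end_apply]
    exact S.smul_mem a hx
  | add p p' hp hp' =>
    intro x hx
    rw [map_add, LinearMap.add_apply]
    exact S.add_mem (hp x hx) (hp' x hx)
  | mul_X p i hp =>
    intro x hx
    rw [map_mul, Module.End.mul_apply]
    refine hp _ ?_
    fin_cases i
    · exact h0 x hx
    · exact h1 x hx

namespace IsCoidealRepr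

variable {q c₁ c₂ κ : ℂ} {b₁ b₂ k ki Z Y : Module.End ℂ V}
  {φ : MvPolynomial (Fin 2) ℂ →ₐ[ℂ] Module.End ℂ V}

theorem k_map_apply (h : IsCoidealRepr q c₁ c₂ b₁ b₂ k ki) (hq : q ≠ 0)
    (hZ : φ (.X 0) = opZ q c₁ c₂ b₁ b₂ k ki) (hY : φ (.X 1) = opY q c₁ c₂ b₁ b₂ k ki)
    (p : MvPolynomial (Fin 2) ℂ) {u : V} (hu : k u = κ • u) : k (φ p u) = κ • φ p u := by
  obtain ⟨h1, h2⟩ := h.k_comm_opZ hq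
  have := mem_of_stable (φ := φ) (S := Module.End.eigenspace k κ) (fun x hx => ?_)
    (fun x hx => ?_) p u (Module.End.mem_eigenspace_iff.2 hu)
  · exact Module.End.mem_eigenspace_iff.1 this
  · rw [Module.End.mem_eigenspace_iff] at hx ⊢
    rw [hZ, ← Module.End.mul_apply, h1, Module.End.mul_apply, hx, map_smul]
  · rw [Module.End.mem_eigenspace_iff] at hx ⊢
    rw [hY, ← Module.End.mul_apply, h2, Module.End.mul_apply, hx, map_smul]

theorem pow_b₁_map_apply (h : IsCoidealRepr q c₁ c₂ b₁ b₂ k ki) (hq : q ≠ 0)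
    (hD : q - q⁻¹ ≠ 0)
    (hZ : φ (.X 0) = opZ q c₁ c₂ b₁ b₂ k ki) (hY : φ (.X 1) = opY q c₁ c₂ b₁ b₂ k ki)
    (p : MvPolynomial (Fin 2) ℂ) {n : ℕ} {u : V} :
    ((b₁ ^ n) u = 0 → (b₁ ^ n) (φ p u) = 0) ∧ ((b₂ ^ n) u = 0 → (b₂ ^ n) (φ p u) = 0) := by
  obtain ⟨h1, h2, h3, h4⟩ := h.comm_opZ hq hD
  have key : ∀ {T b : Module.End ℂ V} {s : ℂ}, s ≠ 0 → T * b = s • (b * T) →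
      ∀ x ∈ LinearMap.ker (b ^ n), T x ∈ LinearMap.ker (b ^ n) := by
    intro T b s hs hT x hx
    rw [LinearMap.mem_ker] at hx ⊢
    have := LinearMap.congr_fun (mul_pow_of_mul_eq_smul hT n) x
    rw [Module.End.mul_apply, hx, map_zero, LinearMap.smul_apply, Module.End.mul_apply] at this
    exact (smul_eq_zero.1 this.symm).resolve_left (pow_ne_zero _ hs)
  constructor <;> intro hu
  · exact mem_of_stable (φ := φ) (S := LinearMap.ker (b₁ ^ n)) (hZ ▸ key hq h1)
      (hY ▸ key (inv_ne_zero hq) h3) p u hu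
  · exact mem_of_stable (φ := φ) (S := LinearMap.ker (b₂ ^ n))
      (hZ ▸ key (inv_ne_zero hq) h2) (hY ▸ key hq h4) p u hu

/-- Turns nilpotency of `b₁` on `u` into a product of lines killing `u`; at zero parameters it also
evaluates the lowest weight vector. -/
theorem pow_b₂_pow_b₁ (h : IsCoidealRepr q c₁ c₂ b₁ b₂ k ki) (hq : q ≠ 0) (hD : q - q⁻¹ ≠ 0)
    (hκ : κ ≠ 0)
    (hZ : φ (.X 0) = opZ q c₁ c₂ b₁ b₂ k ki) (hY : φ (.X 1) = opY q c₁ c₂ b₁ b₂ k ki)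
    {u : V} (hu : k u = κ • u) (r : ℕ) : ∃ c : ℂ, c ≠ 0 ∧ (b₂ ^ r) ((b₁ ^ r) u)
      = c • φ (∏ t ∈ Finset.range r, polyM q c₁ c₂ κ (q ^ (2 * (t : ℤ)))) u := by
  induction r generalizing u with
  | zero => exact ⟨1, one_ne_zero, by simp⟩
  | succ r ih =>
    obtain ⟨c, hc, h1⟩ := ih (u := φ (polyM q c₁ c₂ κ (q ^ (2 * (r : ℤ)))) u)
      (h.k_map_apply hq hZ hY _ hu)
    refine ⟨((q - q⁻¹)⁻¹ * (q ^ r)⁻¹) * c, ?_, ?_⟩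
    · exact mul_ne_zero (mul_ne_zero (inv_ne_zero hD) (inv_ne_zero (pow_ne_zero _ hq))) hc
    · rw [pow_succ b₂, Module.End.mul_apply, h.b₂_b₁_apply hq hD hκ hZ hY hu, map_smul,
        ← map_polyM rfl rfl, h1, smul_smul, Finset.prod_range_succ, map_mul, Module.End.mul_apply]

theorem pow_b₁_pow_b₂ (h : IsCoidealRepr q c₁ c₂ b₁ b₂ k ki) (hq : q ≠ 0) (hD : q - q⁻¹ ≠ 0)
    (hκ : κ ≠ 0)
    (hZ : φ (.X 0) = opZ q c₁ c₂ b₁ b₂ k ki) (hY : φ (.X 1) = opY q c₁ c₂ b₁ b₂ k ki)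
    {u : V} (hu : k u = κ • u) (s : ℕ) : ∃ c : ℂ, c ≠ 0 ∧ (b₁ ^ s) ((b₂ ^ s) u)
      = c • φ (∏ t ∈ Finset.range s, polyM q c₁ c₂ κ (q ^ (2 * (-(t : ℤ) - 1)))) u := by
  induction s generalizing u with
  | zero => exact ⟨1, one_ne_zero, by simp⟩
  | succ s ih =>
    obtain ⟨c, hc, h1⟩ := ih (u := φ (polyM q c₁ c₂ κ (q ^ (2 * (-(s : ℤ) - 1)))) u)
      (h.k_map_apply hq hZ hY _ hu)
    refine ⟨((q - q⁻¹)⁻¹ * (q * q ^ s)) * c, ?_, ?_⟩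
    · exact mul_ne_zero (mul_ne_zero (inv_ne_zero hD) (mul_ne_zero hq (pow_ne_zero _ hq))) hc
    · have h2 := h.b₁_b₂_apply hq hD hκ hZ hY hu 0 s
      simp only [pow_zero, Module.End.one_apply, inv_one, mul_one, Nat.cast_zero, zero_sub] at h2
      rw [pow_succ b₁, Module.End.mul_apply, h2, map_smul,
        ← map_polyM rfl rfl, h1, smul_smul, Finset.prod_range_succ, map_mul, Module.End.mul_apply]

end IsCoidealRepr

/-- The vectors `w 0, …, w n` span a module on which `b₁` lowers and `b₂` raises the weight. -/
structure IsString (q μ : ℂ) (b₁ b₂ k : Module.End ℂ V) (n : ℕ) (w : ℕ → V) : Prop where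
  ne_zero : w 0 ≠ 0
  b₁_zero : b₁ (w 0) = 0
  b₁_succ : ∀ j < n, ∃ η : ℂ, η ≠ 0 ∧ b₁ (w (j + 1)) = η • w j
  b₂_apply : ∀ j, b₂ (w j) = w (j + 1)
  last : w (n + 1) = 0
  k_apply : ∀ j, k (w j) = (μ * q ^ (3 * (j : ℤ))) • w j

/-- The string starts at the bottom, `b₁^r u`, passes through a multiple of `u` after `r` steps up,
and ends after `s` more. All lines met in between act on `u` by nonzero scalars. -/
theorem IsCoidealRepr.isString {q c₁ c₂ κ : ℂ} {b₁ b₂ k ki Z Y : Module.End ℂ V}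
    (h : IsCoidealRepr q c₁ c₂ b₁ b₂ k ki) (hq : q ≠ 0) (hD : q - q⁻¹ ≠ 0)
    (hκ : κ ≠ 0) (hZ : Z = opZ q c₁ c₂ b₁ b₂ k ki) (hY : Y = opY q c₁ c₂ b₁ b₂ k ki)
    {u : V} (hu : k u = κ • u) (hu0 : u ≠ 0) {r s l₁ l₂ : ℕ}
    (hM : ∀ t : ℤ, -(l₂ : ℤ) - 1 ≤ t → t ≤ l₁ → t ≠ r → t ≠ -(s : ℤ) - 1 →
      ∃ γ : ℂ, γ ≠ 0 ∧ opM q c₁ c₂ κ Z Y (q ^ (2 * t)) u = γ • u)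
    (hr : r ≤ l₁) (hs : s ≤ l₂)
    (h₁ : (b₁ ^ (l₁ + 1)) u = 0) (h₂ : (b₂ ^ (l₂ + 1)) u = 0) :
    IsString q (κ * q ^ (-3 * (r : ℤ))) b₁ b₂ k (r + s) (fun j => (b₂ ^ j) ((b₁ ^ r) u)) ∧
      ∃ c : ℂ, c ≠ 0 ∧ (b₂ ^ r) ((b₁ ^ r) u) = c • u := by
  have hqp : ∀ n : ℕ, q ^ n ≠ 0 := fun n => pow_ne_zero n hq
  -- Descending from `l₁ + 1`: as long as the line at the exponent `r + d` is nonzero on `u`,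
  -- applying `b₂` to `b₁^(r+d+1) u = 0` cancels one factor `b₁`. This stops at the line `r`.
  have hb₁ : (b₁ ^ (r + 1)) u = 0 := by
    have : ∀ d, r + d ≤ l₁ → (b₁ ^ (r + d + 1)) u = 0 → (b₁ ^ (r + 1)) u = 0 := by
      intro d
      induction d with
      | zero => intro _ h; exact h
      | succ d ih =>
        intro hd h0
        refine ih (by omega) ?_
        obtain ⟨γ, hγ, h1⟩ := hM ((r + (d + 1) : ℕ) : ℤ) (by omega) (by omega) (by omega)
          (by omega)
        have h2 := h.b₂_b₁_apply hq hD hκ hZ hY hu (r + (d + 1))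
        rw [h0, map_zero, h1, map_smul, smul_smul] at h2
        exact (smul_eq_zero.1 h2.symm).resolve_left
          (mul_ne_zero (mul_ne_zero (inv_ne_zero hD) (inv_ne_zero (hqp _))) hγ)
    obtain ⟨d, rfl⟩ := Nat.exists_eq_add_of_le hr
    exact this d le_rfl h₁
  have hb₂ : (b₂ ^ (s + 1)) u = 0 := by
    have : ∀ d, s + d ≤ l₂ → (b₂ ^ (s + d + 1)) u = 0 → (b₂ ^ (s + 1)) u = 0 := by
      intro d
      induction d with
      | zero => intro _ h; exact h
      | succ d ih =>
        intro hd h0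
        refine ih (by omega) ?_
        obtain ⟨γ, hγ, h1⟩ := hM (((0 : ℕ) : ℤ) - (s + (d + 1) : ℕ) - 1) (by omega) (by omega)
          (by omega) (by omega)
        have h2 := h.b₁_b₂_apply hq hD hκ hZ hY hu 0 (s + (d + 1))
        rw [h1, pow_zero, Module.End.one_apply, h0, map_zero, map_smul, map_smul, smul_smul,
          Module.End.one_apply] at h2
        exact (smul_eq_zero.1 h2.symm).resolve_left (mul_ne_zero (mul_ne_zero (inv_ne_zero hD)
          (mul_ne_zero (mul_ne_zero hq (hqp _)) (inv_ne_zero (by simp)))) hγ)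
    obtain ⟨d, rfl⟩ := Nat.exists_eq_add_of_le hs
    exact this d le_rfl h₂
  have hc : ∀ r', r' ≤ r → ∃ c : ℂ, c ≠ 0 ∧ (b₂ ^ r') ((b₁ ^ r') u) = c • u := by
    intro r'
    induction r' with
    | zero => intro _; exact ⟨1, one_ne_zero, by simp⟩
    | succ m ih =>
      intro hm
      obtain ⟨c, hc, h1⟩ := ih (by omega)
      obtain ⟨γ, hγ, h2⟩ := hM (m : ℤ) (by omega) (by omega) (by omega) (by omega)
      refine ⟨((q - q⁻¹)⁻¹ * (q ^ m)⁻¹) * (γ * c), mul_ne_zero (mul_ne_zero (inv_ne_zero hD)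
        (inv_ne_zero (hqp _))) (mul_ne_zero hγ hc), ?_⟩
      rw [pow_succ b₂, Module.End.mul_apply, h.b₂_b₁_apply hq hD hκ hZ hY hu, h2, map_smul,
        map_smul, map_smul, h1, smul_smul, smul_smul, mul_assoc]
  obtain ⟨c, hc0, hcu⟩ := hc r le_rfl
  refine ⟨⟨?_, ?_, ?_, ?_, ?_, ?_⟩, c, hc0, hcu⟩
  · intro h0
    simp only [pow_zero, Module.End.one_apply] at h0
    rw [h0, map_zero] at hcu
    exact (smul_ne_zero hc0 hu0) hcu.symm
  · simp only [pow_zero, Module.End.one_apply]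
    rw [← Module.End.mul_apply, ← pow_succ', hb₁]
  · intro j hj
    -- For `j < r + s` the exponent runs from `r - 1` down to `-s`, strictly between the two lines
    -- that kill `u`.
    obtain ⟨γ, hγ, h1⟩ := hM ((r : ℤ) - j - 1) (by omega) (by omega) (by omega) (by omega)
    refine ⟨((q - q⁻¹)⁻¹ * (q * q ^ j * (q ^ r)⁻¹)) * γ, mul_ne_zero (mul_ne_zero (inv_ne_zero hD)
      (mul_ne_zero (mul_ne_zero hq (hqp _)) (inv_ne_zero (hqp _)))) hγ, ?_⟩
    rw [h.b₁_b₂_apply hq hD hκ hZ hY hu, h1, map_smul, map_smul, smul_smul]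
  · intro j
    rw [pow_succ', Module.End.mul_apply]
  · rw [show r + s + 1 = (s + 1) + r by ring, pow_add, Module.End.mul_apply, hcu, map_smul, hb₂,
      smul_zero]
  · intro j
    have ap : ∀ {a b : Module.End ℂ V} {t : ℂ}, a * b = t • (b * a) → ∀ (n : ℕ) (x : V),
      a ((b ^ n) x) = t ^ n • (b ^ n) (a x) := fun hab n x =>
        LinearMap.congr_fun (mul_pow_of_mul_eq_smul hab n) x
    rw [ap h.k_b₂, ap h.k_b₁, hu]
    simp only [map_smul, smul_smul]
    congr 1
    rw [zpow_mul, zpow_mul, zpow_neg]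
    simp only [zpow_natCast]
    have : q ^ (3 : ℤ) = q ^ 3 := by norm_cast
    rw [this]
    ring

namespace IsString

variable {q μ : ℂ} {b₁ b₂ k : Module.End ℂ V} {n : ℕ} {w : ℕ → V}

theorem apply_ne_zero (h : IsString q μ b₁ b₂ k n w) : ∀ j ≤ n, w j ≠ 0
  | 0, _ => h.ne_zero
  | j + 1, hj => by
    obtain ⟨η, hη, h1⟩ := h.b₁_succ j hj
    intro h0
    rw [h0, map_zero] at h1
    exact smul_ne_zero hη (h.apply_ne_zero j (by omega)) h1.symm

/-- The span of a string. -/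
def toSubmodule (w : ℕ → V) (n : ℕ) : Submodule ℂ V :=
  Submodule.span ℂ (Set.range fun j : Fin (n + 1) => w j)

theorem mem_toSubmodule (h : IsString q μ b₁ b₂ k n w) (j : ℕ) : w j ∈ toSubmodule w n := by
  have hlast : ∀ d, w (n + 1 + d) = 0 := by
    intro d
    induction d with
    | zero => exact h.last
    | succ d ih => rw [← add_assoc, ← h.b₂_apply, ih, map_zero]
  rcases Nat.lt_or_ge j (n + 1) with hj | hj
  · exact Submodule.subset_span ⟨⟨j, hj⟩, rfl⟩
  · obtain ⟨d, rfl⟩ := Nat.exists_eq_add_of_le hj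
    rw [hlast]; exact zero_mem _

theorem stable {T : Module.End ℂ V}
    (hT : ∀ j ≤ n, T (w j) ∈ toSubmodule w n) : ∀ x ∈ toSubmodule w n, T x ∈ toSubmodule w n := by
  intro x hx
  have : toSubmodule w n ≤ (toSubmodule w n).comap T := by
    rw [toSubmodule, Submodule.span_le]
    rintro _ ⟨j, rfl⟩
    exact hT j (Nat.lt_succ_iff.1 j.2)
  exact this hx

theorem stable_b₁ (h : IsString q μ b₁ b₂ k n w) :
    ∀ x ∈ toSubmodule w n, b₁ x ∈ toSubmodule w n := by
  refine stable fun j hj => ?_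
  cases j with
  | zero => rw [h.b₁_zero]; exact zero_mem _
  | succ j =>
    obtain ⟨η, -, h1⟩ := h.b₁_succ j hj
    rw [h1]
    exact Submodule.smul_mem _ _ (h.mem_toSubmodule j)

theorem stable_b₂ (h : IsString q μ b₁ b₂ k n w) :
    ∀ x ∈ toSubmodule w n, b₂ x ∈ toSubmodule w n :=
  stable fun j _ => by rw [h.b₂_apply]; exact h.mem_toSubmodule _

theorem stable_k (h : IsString q μ b₁ b₂ k n w) :
    ∀ x ∈ toSubmodule w n, k x ∈ toSubmodule w n :=
  stable fun j _ => by rw [h.k_apply]; exact Submodule.smul_mem _ _ (h.mem_toSubmodule _)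

theorem linearIndependent (h : IsString q μ b₁ b₂ k n w) (hμ : μ ≠ 0)
    (hq : Function.Injective fun t : ℤ => q ^ t) :
    LinearIndependent ℂ fun j : Fin (n + 1) => w j := by
  refine Module.End.eigenvectors_linearIndependent' k
    (fun j : Fin (n + 1) => μ * q ^ (3 * ((j : ℕ) : ℤ))) ?_ _ fun j =>
      ⟨Module.End.mem_eigenspace_iff.2 (h.k_apply j), h.apply_ne_zero j (Nat.lt_succ_iff.1 j.2)⟩
  intro i j hij
  have := hq (mul_left_cancel₀ hμ hij)
  ext; omega

theorem finrank_toSubmodule (h : IsString q μ b₁ b₂ k n w) (hμ : μ ≠ 0)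
    (hq : Function.Injective fun t : ℤ => q ^ t) :
    Module.finrank ℂ (toSubmodule w n) = n + 1 := by
  exact (finrank_span_eq_card (h.linearIndependent hμ hq)).trans (by simp)

theorem exists_smul_of_b₁_eq_zero (h : IsString q μ b₁ b₂ k n w) (hμ : μ ≠ 0)
    (hq : Function.Injective fun t : ℤ => q ^ t) {x : V} (hx : x ∈ toSubmodule w n)
    (h0 : b₁ x = 0) : ∃ c : ℂ, x = c • w 0 := by
  obtain ⟨a, rfl⟩ := (Submodule.mem_span_range_iff_exists_fun ℂ).1 hx
  choose! η hη hb using h.b₁_succ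
  rw [Fin.sum_univ_succ, map_add, map_smul, Fin.val_zero, h.b₁_zero, smul_zero, zero_add,
    map_sum] at h0
  have h1 : ∑ j : Fin n, (a j.succ * η j) • w j = 0 := by
    rw [← h0]
    refine Finset.sum_congr rfl fun j _ => ?_
    rw [map_smul, Fin.val_succ, hb j j.2, smul_smul]
  have h2 := Fintype.linearIndependent_iff.1
    ((h.linearIndependent hμ hq).comp (Fin.castSucc : Fin n → _) (Fin.castSucc_injective n)) _ h1
  refine ⟨a 0, ?_⟩
  rw [Fin.sum_univ_succ, Fin.val_zero, Finset.sum_eq_zero, add_zero]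
  intro j _
  rw [(mul_eq_zero.1 (h2 j)).resolve_right (hη j j.2), zero_smul]

theorem eq_zero_of_k_apply (h : IsString q μ b₁ b₂ k n w) (hμ : μ ≠ 0)
    (hq : Function.Injective fun t : ℤ => q ^ t) {x : V} (hx : x ∈ toSubmodule w n)
    (h0 : k x = (q ^ (-3 : ℤ) * μ) • x) : x = 0 := by
  obtain ⟨a, rfl⟩ := (Submodule.mem_span_range_iff_exists_fun ℂ).1 hx
  have h1 : ∑ j : Fin (n + 1), (a j * (μ * q ^ (3 * ((j : ℕ) : ℤ)) - μ * q ^ (-3 : ℤ))) • w j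
      = 0 := by
    rw [map_sum, Finset.smul_sum, ← sub_eq_zero, ← Finset.sum_sub_distrib] at h0
    rw [← h0]
    refine Finset.sum_congr rfl fun j _ => ?_
    rw [map_smul, h.k_apply, smul_smul, smul_smul, ← sub_smul]
    congr 1; ring
  have h2 := Fintype.linearIndependent_iff.1 (h.linearIndependent hμ hq) _ h1
  refine Finset.sum_eq_zero fun j _ => ?_
  rw [(mul_eq_zero.1 (h2 j)).resolve_right, zero_smul]
  intro h3
  have := hq (mul_left_cancel₀ hμ (sub_eq_zero.1 h3))
  omega

/-- Applying `b₁` to a nonzero vector of `S` as long as the result is nonzero ends in the kernel of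
`b₁`, which is the line of `w 0`; from `w 0` the operator `b₂` recovers the whole string. -/
theorem eq_of_stable (h : IsString q μ b₁ b₂ k n w) (hμ : μ ≠ 0)
    (hq : Function.Injective fun t : ℤ => q ^ t) {S : Submodule ℂ V} (hS : S ≤ toSubmodule w n)
    (hS0 : S ≠ ⊥) (hb₁ : ∀ x ∈ S, b₁ x ∈ S) (hb₂ : ∀ x ∈ S, b₂ x ∈ S) : S = toSubmodule w n := by
  obtain ⟨x, hxS, hx0⟩ := Submodule.exists_mem_ne_zero_of_ne_bot hS0
  have hnil : ∀ j ≤ n, (b₁ ^ (j + 1)) (w j) = 0 := by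
    intro j
    induction j with
    | zero => intro _; simpa using h.b₁_zero
    | succ j ih =>
      intro hj
      obtain ⟨η, -, h1⟩ := h.b₁_succ j hj
      rw [pow_succ, Module.End.mul_apply, h1, map_smul, ih (by omega), smul_zero]
  have hker : toSubmodule w n ≤ LinearMap.ker (b₁ ^ (n + 1)) := by
    rw [toSubmodule, Submodule.span_le]
    rintro _ ⟨j, rfl⟩
    have e : b₁ ^ (n + 1) = b₁ ^ (n - (j : ℕ)) * b₁ ^ ((j : ℕ) + 1) := by
      rw [← pow_add]; congr 1; omega
    rw [SetLike.mem_coe, LinearMap.mem_ker, e, Module.End.mul_apply,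
      hnil j (Nat.lt_succ_iff.1 j.2), map_zero]
  have hex : ∃ m, (b₁ ^ m) x = 0 := ⟨n + 1, hker (hS hxS)⟩
  classical
  obtain ⟨m, hm⟩ : ∃ m, Nat.find hex = m + 1 := by
    refine Nat.exists_eq_succ_of_ne_zero fun h0 => hx0 ?_
    have := Nat.find_spec hex
    rw [h0] at this
    simpa using this
  have hpow : ∀ j, (b₁ ^ j) x ∈ S := by
    intro j
    induction j with
    | zero => simpa using hxS
    | succ j ih => rw [pow_succ', Module.End.mul_apply]; exact hb₁ _ ih
  have hy0 : (b₁ ^ m) x ≠ 0 := Nat.find_min hex (by omega)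
  have hy : b₁ ((b₁ ^ m) x) = 0 := by
    rw [← Module.End.mul_apply, ← pow_succ', ← hm]; exact Nat.find_spec hex
  obtain ⟨c, hc⟩ := h.exists_smul_of_b₁_eq_zero hμ hq (hS (hpow m)) hy
  have hc0 : c ≠ 0 := by
    rintro rfl; rw [zero_smul] at hc; exact hy0 hc
  have hw0 : w 0 ∈ S := by
    have := S.smul_mem c⁻¹ (hpow m)
    rwa [hc, smul_smul, inv_mul_cancel₀ hc0, one_smul] at this
  have hw : ∀ j, w j ∈ S := by
    intro j
    induction j with
    | zero => exact hw0
    | succ j ih => rw [← h.b₂_apply]; exact hb₂ _ ih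
  refine le_antisymm hS ?_
  rw [toSubmodule, Submodule.span_le]
  rintro _ ⟨j, rfl⟩
  exact hw j

end IsString
end Lines
-- Highest weight vectors in rank one.
section Rank1

variable {V : Type*} [AddCommGroup V] [Module ℂ V] {q : ℂ} {e f k ki : Module.End ℂ V}

/-- The string of a highest weight vector for `U_q(sl(2))`. -/
theorem e_pow_f_apply (hq : q ≠ 0) (hD : q - q⁻¹ ≠ 0) (hki : ki * k = 1)
    (hkf : k * f = (q ^ 2)⁻¹ • (f * k)) (hkif : ki * f = q ^ 2 • (f * ki))
    (hef : e * f = f * e + (q - q⁻¹)⁻¹ • (k - ki)) {N : ℕ} {u : V} (he : e u = 0)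
    (hk : k u = q ^ N • u) (j : ℕ) :
    e ((f ^ (j + 1)) u) = ((q - q⁻¹)⁻¹ ^ 2 * (q ^ (j + 1) - (q ^ (j + 1))⁻¹)
      * (q ^ N * (q ^ j)⁻¹ - q ^ j * (q ^ N)⁻¹)) • (f ^ j) u := by
  have hqp : ∀ n : ℕ, q ^ n ≠ 0 := fun n => pow_ne_zero n hq
  have hkiu : ki u = (q ^ N)⁻¹ • u := by
    have h1 : ki (k u) = u := by rw [← Module.End.mul_apply, hki, Module.End.one_apply]
    rw [hk, map_smul] at h1
    conv_rhs => rw [← h1]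
    rw [smul_smul, inv_mul_cancel₀ (hqp N), one_smul]
  have hkj : ∀ j : ℕ, (k - ki) ((f ^ j) u)
      = (q ^ N * ((q ^ j)⁻¹) ^ 2 - (q ^ j) ^ 2 * (q ^ N)⁻¹) • (f ^ j) u := by
    intro j
    have h1 := LinearMap.congr_fun (mul_pow_of_mul_eq_smul hkf j) u
    have h2 := LinearMap.congr_fun (mul_pow_of_mul_eq_smul hkif j) u
    simp only [Module.End.mul_apply, LinearMap.smul_apply] at h1 h2
    rw [LinearMap.sub_apply, h1, h2, hk, hkiu, map_smul, map_smul, smul_smul, smul_smul, ← sub_smul]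
    congr 1
    rw [inv_pow, inv_pow, ← pow_mul, ← pow_mul, mul_comm 2 j]
    ring
  have hD2 : q ^ 2 - 1 ≠ 0 := by
    intro h; apply hD; field_simp; linear_combination h
  have hstep : ∀ x, e (f x) = f (e x) + (q - q⁻¹)⁻¹ • (k - ki) x := fun x =>
    LinearMap.congr_fun hef x
  induction j with
  | zero =>
    rw [zero_add, pow_one, hstep, he, map_zero, zero_add]
    have := hkj 0
    simp only [pow_zero, Module.End.one_apply] at this ⊢
    rw [this, smul_smul]
    congr 1
    field_simp
  | succ j ih =>
    rw [pow_succ' f, Module.End.mul_apply, hstep, ih, hkj, map_smul, ← Module.End.mul_apply f,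
      ← pow_succ', smul_smul, ← add_smul]
    congr 1
    have := hqp j
    have := hqp N
    simp only [pow_succ]
    generalize q ^ j = t at *
    generalize q ^ N = T at *
    field_simp
    ring

/-- The coefficient is the product of q-integers `[j+1][N-j]`, and injectivity of `t ↦ q^t` makes
`[m]` vanish only at `m = 0`. -/
theorem e_pow_f_coeff_ne_zero (hq : q ≠ 0) (hD : q - q⁻¹ ≠ 0)
    (hinj : Function.Injective fun t : ℤ => q ^ t) {N j : ℕ} (hj : j ≠ N) :
    (q - q⁻¹)⁻¹ ^ 2 * (q ^ (j + 1) - (q ^ (j + 1))⁻¹) * (q ^ N * (q ^ j)⁻¹ - q ^ j * (q ^ N)⁻¹)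
      ≠ 0 := by
  refine mul_ne_zero (mul_ne_zero (pow_ne_zero _ (inv_ne_zero hD)) ?_) ?_
  · intro h
    have : q ^ ((j + 1 : ℕ) : ℤ) = q ^ (-((j + 1 : ℕ) : ℤ)) := by
      rw [zpow_neg, zpow_natCast]; exact sub_eq_zero.1 h
    have := hinj this
    omega
  · intro h
    have : q ^ ((N : ℤ) - j) = q ^ ((j : ℤ) - N) := by
      rw [zpow_sub₀ hq, zpow_sub₀ hq]
      simpa [div_eq_mul_inv] using sub_eq_zero.1 h
    have := hinj this
    omega

theorem pow_f_apply_ne_zero (hq : q ≠ 0) (hD : q - q⁻¹ ≠ 0)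
    (hinj : Function.Injective fun t : ℤ => q ^ t) (hki : ki * k = 1)
    (hkf : k * f = (q ^ 2)⁻¹ • (f * k)) (hkif : ki * f = q ^ 2 • (f * ki))
    (hef : e * f = f * e + (q - q⁻¹)⁻¹ • (k - ki)) {N : ℕ} {u : V} (he : e u = 0)
    (hk : k u = q ^ N • u) (hu : u ≠ 0) : ∀ j ≤ N, (f ^ j) u ≠ 0
  | 0, _ => by simpa using hu
  | j + 1, hj => by
    intro h0
    have h1 := e_pow_f_apply hq hD hki hkf hkif hef he hk j
    rw [h0, map_zero] at h1
    exact smul_ne_zero (e_pow_f_coeff_ne_zero hq hD hinj (by omega))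
      (pow_f_apply_ne_zero hq hD hinj hki hkf hkif hef he hk hu j (by omega)) h1.symm

/-- Otherwise all higher `f^m u` would be nonzero eigenvectors of `k` with distinct eigenvalues,
impossible in finite dimension. -/
theorem pow_f_apply_eq_zero [FiniteDimensional ℂ V] (hq : q ≠ 0) (hD : q - q⁻¹ ≠ 0)
    (hinj : Function.Injective fun t : ℤ => q ^ t) (hki : ki * k = 1)
    (hkf : k * f = (q ^ 2)⁻¹ • (f * k)) (hkif : ki * f = q ^ 2 • (f * ki))
    (hef : e * f = f * e + (q - q⁻¹)⁻¹ • (k - ki)) {N : ℕ} {u : V} (he : e u = 0)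
    (hk : k u = q ^ N • u) : (f ^ (N + 1)) u = 0 := by
  by_contra h0
  have hne : ∀ d, (f ^ (N + 1 + d)) u ≠ 0 := by
    intro d
    induction d with
    | zero => exact h0
    | succ d ih =>
      intro h2
      have h1 := e_pow_f_apply hq hD hki hkf hkif hef he hk (N + 1 + d)
      rw [add_assoc (N + 1), h2, map_zero] at h1
      exact smul_ne_zero (e_pow_f_coeff_ne_zero (j := N + 1 + d) hq hD hinj (by omega)) ih h1.symm
  have hμ : Function.Injective fun d : ℕ => q ^ (-(2 * ((N + 1 + d : ℕ) : ℤ))) * q ^ N := by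
    intro a b hab
    have h1 : -(2 * ((N + 1 + a : ℕ) : ℤ)) = -(2 * ((N + 1 + b : ℕ) : ℤ)) :=
      hinj (mul_right_cancel₀ (pow_ne_zero N hq) hab)
    omega
  have hli := Module.End.eigenvectors_linearIndependent' k _ hμ (fun d => (f ^ (N + 1 + d)) u) fun d => ⟨Module.End.mem_eigenspace_iff.2 (by
      have h1 := LinearMap.congr_fun (mul_pow_of_mul_eq_smul hkf (N + 1 + d)) u
      simp only [Module.End.mul_apply, LinearMap.smul_apply] at h1
      rw [h1, hk, map_smul, smul_smul]
      congr 2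
      rw [zpow_neg, zpow_mul, zpow_natCast, inv_pow]
      norm_cast), hne d⟩
  have := hli.finite
  exact not_finite ℕ

end Rank1

/-! ### Filtration of a highest weight module by word length. -/

section Filtration

variable {V : Type*} [AddCommGroup V] [Module ℂ V]

/-- The span of the vectors obtained from `v` by applying fewer than `n` of the operators `f i`. -/
def wordFiltration (f : Fin 2 → Module.End ℂ V) (v : V) : ℕ → Submodule ℂ V
  | 0 => ⊥
  | n + 1 => Submodule.span ℂ {v} ⊔ (wordFiltration f v n).map (f 0)
      ⊔ (wordFiltration f v n).map (f 1)

variable {f : Fin 2 → Module.End ℂ V} {v : V}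

theorem mem_wordFiltration_one : v ∈ wordFiltration f v 1 :=
  Submodule.mem_sup_left (Submodule.mem_sup_left (Submodule.mem_span_singleton_self v))

theorem f_mem_wordFiltration (i : Fin 2) {n : ℕ} {x : V} (hx : x ∈ wordFiltration f v n) :
    f i x ∈ wordFiltration f v (n + 1) := by
  fin_cases i
  · exact Submodule.mem_sup_left (Submodule.mem_sup_right (Submodule.mem_map_of_mem hx))
  · exact Submodule.mem_sup_right (Submodule.mem_map_of_mem hx)

theorem wordFiltration_succ_le {n : ℕ} {S : Submodule ℂ V} (hv : v ∈ S)
    (hf : ∀ i, ∀ x ∈ wordFiltration f v n, f i x ∈ S) : wordFiltration f v (n + 1) ≤ S := by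
  refine sup_le (sup_le ?_ ?_) ?_
  · rwa [Submodule.span_le, Set.singleton_subset_iff]
  · rw [Submodule.map_le_iff_le_comap]; exact fun x hx => hf 0 x hx
  · rw [Submodule.map_le_iff_le_comap]; exact fun x hx => hf 1 x hx

theorem wordFiltration_mono : Monotone (wordFiltration f v) := by
  refine monotone_nat_of_le_succ fun n => ?_
  induction n with
  | zero => exact bot_le
  | succ n ih =>
    refine wordFiltration_succ_le ?_ fun i x hx => f_mem_wordFiltration i (ih hx)
    exact Submodule.mem_sup_left (Submodule.mem_sup_left (Submodule.mem_span_singleton_self v))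

theorem stable_wordFiltration {T : Module.End ℂ V} (hv : ∃ c : ℂ, T v = c • v)
    (hf : ∀ i, ∃ c : ℂ, T * f i = c • (f i * T)) :
    ∀ (n : ℕ), ∀ x ∈ wordFiltration f v n, T x ∈ wordFiltration f v n := by
  intro n
  induction n with
  | zero => intro x hx; rw [(Submodule.mem_bot ℂ).1 hx, map_zero]; exact zero_mem _
  | succ n ih =>
    refine wordFiltration_succ_le (S := (wordFiltration f v (n + 1)).comap T) ?_ fun i x hx => ?_
    · obtain ⟨c, hc⟩ := hv
      rw [Submodule.mem_comap, hc]
      exact Submodule.smul_mem _ _ (wordFiltration_mono (by omega) mem_wordFiltration_one)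
    · obtain ⟨c, hc⟩ := hf i
      rw [Submodule.mem_comap, ← Module.End.mul_apply, hc]
      exact Submodule.smul_mem _ _ (f_mem_wordFiltration i (ih x hx))

namespace IsRepr

variable {q : ℂ} {e k ki : Fin 2 → Module.End ℂ V} {l : Fin 2 → ℕ}

theorem ki_v (h : IsRepr q e f k ki) (hq : q ≠ 0) (hk : ∀ i, k i v = q ^ l i • v) (i : Fin 2) :
    ki i v = (q ^ l i)⁻¹ • v := by
  have h1 : ki i (k i v) = v := by rw [← Module.End.mul_apply, h.ki_mul_k, Module.End.one_apply]
  rw [hk, map_smul] at h1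
  conv_rhs => rw [← h1]
  rw [smul_smul, inv_mul_cancel₀ (pow_ne_zero _ hq), one_smul]

theorem k_stable (h : IsRepr q e f k ki) (hk : ∀ i, k i v = q ^ l i • v) (i : Fin 2) :
    ∀ (n : ℕ), ∀ x ∈ wordFiltration f v n, k i x ∈ wordFiltration f v n :=
  stable_wordFiltration ⟨_, hk i⟩ fun j => by
    by_cases hij : i = j
    · subst hij; exact ⟨_, h.k_f_same i⟩
    · exact ⟨_, h.k_f_ne i j hij⟩

theorem ki_stable (h : IsRepr q e f k ki) (hq : q ≠ 0) (hk : ∀ i, k i v = q ^ l i • v)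
    (i : Fin 2) :
    ∀ (n : ℕ), ∀ x ∈ wordFiltration f v n, ki i x ∈ wordFiltration f v n :=
  stable_wordFiltration ⟨_, h.ki_v hq hk i⟩ fun j => by
    by_cases hij : i = j
    · subst hij; exact ⟨_, h.ki_f_same hq i⟩
    · exact ⟨_, h.ki_f_ne hq i j hij⟩

/-- Commuting `e i` past a letter `f j` either leaves the letter in place or replaces it by Cartan
elements, and at the end `e i` kills `v`; so one letter is lost. -/
theorem e_mem (h : IsRepr q e f k ki) (hq : q ≠ 0) (he : ∀ i, e i v = 0)
    (hk : ∀ i, k i v = q ^ l i • v) (i : Fin 2) :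
    ∀ (n : ℕ), ∀ x ∈ wordFiltration f v (n + 1), e i x ∈ wordFiltration f v n := by
  intro n
  induction n with
  | zero =>
    refine wordFiltration_succ_le (S := (wordFiltration f v 0).comap (e i)) ?_ fun j x hx => ?_
    · rw [Submodule.mem_comap, he]; exact zero_mem _
    · rw [(Submodule.mem_bot ℂ).1 hx, map_zero]; exact zero_mem _
  | succ n ih =>
    refine wordFiltration_succ_le (S := (wordFiltration f v (n + 1)).comap (e i)) ?_
      fun j x hx => ?_
    · rw [Submodule.mem_comap, he]; exact zero_mem _
    · rw [Submodule.mem_comap, ← Module.End.mul_apply]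
      have h1 : f j (e i x) ∈ wordFiltration f v (n + 1) := f_mem_wordFiltration j (ih x hx)
      by_cases hij : i = j
      · subst hij
        rw [h.e_f_same]
        exact add_mem h1 (Submodule.smul_mem _ _ (sub_mem (h.k_stable hk i _ x hx)
          (h.ki_stable hq hk i _ x hx)))
      · rw [h.e_f_ne i j hij]
        exact h1

/-- Both simple roots pair to `2 - 1 = 1` with `K₁K₂`, so its eigenvalues record word length. -/
theorem k_mul_k_f (h : IsRepr q e f k ki) (hq : q ≠ 0) (i : Fin 2) :
    k 0 * k 1 * f i = q⁻¹ • (f i * (k 0 * k 1)) := by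
  have h01 : (0 : Fin 2) ≠ 1 := by decide
  fin_cases i
  · simp only [Fin.zero_eta]
    rw [mul_assoc, h.k_f_ne 1 0 h01.symm, mul_smul_comm, ← mul_assoc, h.k_f_same, smul_mul_assoc,
      smul_smul, mul_assoc]
    congr 1; field_simp
  · simp only [Fin.mk_one]
    rw [mul_assoc, h.k_f_same, mul_smul_comm, ← mul_assoc, h.k_f_ne 0 1 h01, smul_mul_assoc,
      smul_smul, mul_assoc]
    congr 1; field_simp

theorem f_mem_eigenspace (h : IsRepr q e f k ki) (hq : q ≠ 0) (i : Fin 2) {t : ℤ} {x : V}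
    (hx : x ∈ Module.End.eigenspace (k 0 * k 1) (q ^ t)) :
    f i x ∈ Module.End.eigenspace (k 0 * k 1) (q ^ (t - 1)) := by
  rw [Module.End.mem_eigenspace_iff] at hx ⊢
  rw [← Module.End.mul_apply, h.k_mul_k_f hq, LinearMap.smul_apply, Module.End.mul_apply, hx,
    map_smul, smul_smul, zpow_sub_one₀ hq, mul_comm]

theorem v_mem_eigenspace (hq : q ≠ 0) (hk : ∀ i, k i v = q ^ l i • v) :
    v ∈ Module.End.eigenspace (k 0 * k 1) (q ^ ((l 0 : ℤ) + l 1)) := by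
  rw [Module.End.mem_eigenspace_iff, Module.End.mul_apply, hk, map_smul, hk, smul_smul,
    zpow_add₀ hq, zpow_natCast, zpow_natCast, mul_comm]

theorem wordFiltration_le (h : IsRepr q e f k ki) (hq : q ≠ 0) (hk : ∀ i, k i v = q ^ l i • v)
    (n : ℕ) : wordFiltration f v n ≤
      ⨆ j : Fin n, Module.End.eigenspace (k 0 * k 1) (q ^ ((l 0 : ℤ) + l 1 - (j : ℕ))) := by
  induction n with
  | zero => exact bot_le
  | succ n ih =>
    refine wordFiltration_succ_le ?_ fun i x hx => ?_
    · refine Submodule.mem_iSup_of_mem 0 ?_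
      simpa using v_mem_eigenspace hq hk
    · have h1 := Submodule.mem_map_of_mem (f := f i) (ih hx)
      rw [Submodule.map_iSup] at h1
      refine SetLike.le_def.1 (iSup_le fun j => ?_) h1
      rintro _ ⟨y, hy, rfl⟩
      refine Submodule.mem_iSup_of_mem j.succ ?_
      have := h.f_mem_eigenspace hq i hy
      convert this using 3
      rw [Fin.val_succ]; push_cast; ring

/-- Words of length less than `n` have `K₁K₂`-eigenvalues different from that of words of length
`n`. This makes leading terms well defined. -/
theorem eq_zero_of_mem_wordFiltration (h : IsRepr q e f k ki) (hq : q ≠ 0)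
    (hinj : Function.Injective fun t : ℤ => q ^ t) (hk : ∀ i, k i v = q ^ l i • v) {n : ℕ} {x : V}
    (hx : x ∈ wordFiltration f v n)
    (hx' : x ∈ Module.End.eigenspace (k 0 * k 1) (q ^ ((l 0 : ℤ) + l 1 - n))) : x = 0 := by
  have h1 := (Module.End.eigenspaces_iSupIndep (k 0 * k 1)) (q ^ ((l 0 : ℤ) + l 1 - n))
  refine Submodule.disjoint_def.1 h1 x hx' ?_
  refine SetLike.le_def.1 (iSup_le fun j => ?_) (h.wordFiltration_le hq hk n hx)
  refine le_iSup₂_of_le (q ^ ((l 0 : ℤ) + l 1 - (j : ℕ))) ?_ le_rfl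
  intro he
  have := hinj he
  have := j.2
  omega

/-- The union of the word filtration is stable under all generators. -/
theorem iSup_wordFiltration_stable (h : IsRepr q e f k ki) (hq : q ≠ 0) (he : ∀ i, e i v = 0)
    (hk : ∀ i, k i v = q ^ l i • v) {x : V} (hx : x ∈ ⨆ n, wordFiltration f v n) (i : Fin 2) :
    e i x ∈ ⨆ n, wordFiltration f v n ∧ f i x ∈ ⨆ n, wordFiltration f v n ∧
    k i x ∈ ⨆ n, wordFiltration f v n ∧ ki i x ∈ ⨆ n, wordFiltration f v n := by
  obtain ⟨n, hn⟩ := (Submodule.mem_iSup_of_directed _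
    wordFiltration_mono.directed_le).1 hx
  exact ⟨Submodule.mem_iSup_of_mem n (h.e_mem hq he hk i n x (wordFiltration_mono n.le_succ hn)),
    Submodule.mem_iSup_of_mem (n + 1) (f_mem_wordFiltration i hn),
    Submodule.mem_iSup_of_mem n (h.k_stable hk i n x hn),
    Submodule.mem_iSup_of_mem n (h.ki_stable hq hk i n x hn)⟩

/-- By induction on word length: `F_i` is `B_i` plus a term that shortens words. Consequently `v`
generates over `𝓑` all that it generates under the `F_i`. -/
theorem wordFiltration_le_of_coideal_stable (h : IsRepr q e f k ki) (hq : q ≠ 0)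
    (he : ∀ i, e i v = 0) (hk : ∀ i, k i v = q ^ l i • v) {c₁ c₂ : ℂ} {S : Submodule ℂ V}
    (hv : v ∈ S) (h₁ : ∀ x ∈ S, (f 0 - c₁ • (e 1 * ki 0)) x ∈ S)
    (h₂ : ∀ x ∈ S, (f 1 - c₂ • (e 0 * ki 1)) x ∈ S) (n : ℕ) : wordFiltration f v n ≤ S := by
  induction n with
  | zero => exact bot_le
  | succ n ih =>
    refine wordFiltration_succ_le hv fun i x hx => ?_
    have he' : ∀ i j, e i (ki j x) ∈ S := fun i j =>
      ih (h.e_mem hq he hk i n _ (wordFiltration_mono n.le_succ (h.ki_stable hq hk j n x hx)))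
    fin_cases i
    · have := S.add_mem (h₁ x (ih hx)) (S.smul_mem c₁ (he' 1 0))
      simpa using this
    · have := S.add_mem (h₂ x (ih hx)) (S.smul_mem c₂ (he' 0 1))
      simpa using this

end IsRepr
end Filtration
-- Leading terms and the lowest weight vector.
section Leading

variable {V : Type*} [AddCommGroup V] [Module ℂ V] {q c₁ c₂ κ : ℂ}
  {e f k ki : Fin 2 → Module.End ℂ V} {v : V} {l : Fin 2 → ℕ}

theorem opM_zero_apply (f₀ f₁ k ki : Module.End ℂ V) (a : ℂ) (x : V) :
    opM q 0 0 κ (opZ q 0 0 f₀ f₁ k ki) (opY q 0 0 f₀ f₁ k ki) a x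
      = (1 - a) • f₀ (f₁ x) + (a * q - q⁻¹) • f₁ (f₀ x) := by
  simp only [opM, opZ, opY, mul_zero, zero_mul, zero_smul, add_zero, smul_zero,
    sub_zero, LinearMap.sub_apply, LinearMap.smul_apply, Module.End.mul_apply]
  module

namespace IsRepr

/-- Each `F` adds a letter and each `E K⁻¹` removes one, so every term of the product other than
`F_i F_j` has nonpositive total degree. -/
theorem coideal_mul_sub_mem (h : IsRepr q e f k ki) (hq : q ≠ 0) (he : ∀ i, e i v = 0)
    (hk : ∀ i, k i v = q ^ l i • v) (c c' : ℂ) (i j : Fin 2) {n : ℕ} {x : V}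
    (hx : x ∈ wordFiltration f v n) :
    (f i - c • (e j * ki i)) ((f j - c' • (e i * ki j)) x) - f i (f j x)
      ∈ wordFiltration f v n := by
  cases n with
  | zero =>
    rw [(Submodule.mem_bot ℂ).1 hx]; simp
  | succ n =>
    have hy : ∀ (i j : Fin 2) (n : ℕ) (x : V), x ∈ wordFiltration f v (n + 1) →
        e i (ki j x) ∈ wordFiltration f v n := fun i j n x hx =>
      h.e_mem hq he hk i n _ (h.ki_stable hq hk j _ x hx)
    have h1 := f_mem_wordFiltration i (hy i j n x hx)
    have h2 := hy j i _ _ (f_mem_wordFiltration j hx)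
    have h3 := hy j i _ _ (wordFiltration_mono (Nat.le_succ _)
      (wordFiltration_mono (Nat.le_succ _) (hy i j n x hx)))
    have e1 : (f i - c • (e j * ki i)) ((f j - c' • (e i * ki j)) x) - f i (f j x)
        = (-c') • f i (e i (ki j x)) + (-c) • e j (ki i (f j x))
          + (c * c') • e j (ki i (e i (ki j x))) := by
      simp only [LinearMap.sub_apply, LinearMap.smul_apply, Module.End.mul_apply, map_sub,
        map_smul]
      module
    rw [e1]
    exact add_mem (add_mem (Submodule.smul_mem _ _ h1) (Submodule.smul_mem _ _ h2))
      (Submodule.smul_mem _ _ h3)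

theorem opM_sub_mem (h : IsRepr q e f k ki) (hq : q ≠ 0) (he : ∀ i, e i v = 0)
    (hk : ∀ i, k i v = q ^ l i • v) {Z Y : Module.End ℂ V}
    (hZ : Z = opZ q c₁ c₂ (f 0 - c₁ • (e 1 * ki 0)) (f 1 - c₂ • (e 0 * ki 1)) (k 0 * ki 1)
      (k 1 * ki 0))
    (hY : Y = opY q c₁ c₂ (f 0 - c₁ • (e 1 * ki 0)) (f 1 - c₂ • (e 0 * ki 1)) (k 0 * ki 1)
      (k 1 * ki 0)) (a : ℂ) {n : ℕ} {x : V} (hx : x ∈ wordFiltration f v n) :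
    opM q c₁ c₂ κ Z Y a x - ((1 - a) • f 0 (f 1 x) + (a * q - q⁻¹) • f 1 (f 0 x))
      ∈ wordFiltration f v n := by
  have h1 := h.coideal_mul_sub_mem hq he hk c₁ c₂ 0 1 hx
  have h2 := h.coideal_mul_sub_mem hq he hk c₂ c₁ 1 0 hx
  have h3 := h.k_stable hk 0 n _ (h.ki_stable hq hk 1 n x hx)
  have h4 := h.k_stable hk 1 n _ (h.ki_stable hq hk 0 n x hx)
  rw [hZ, hY]
  generalize f 0 - c₁ • (e 1 * ki 0) = b₁ at *
  generalize f 1 - c₂ • (e 0 * ki 1) = b₂ at *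
  simp only [opM, opZ, opY, LinearMap.sub_apply, LinearMap.add_apply, LinearMap.smul_apply,
    Module.End.mul_apply, Module.End.one_apply]
  have e1 : ∀ (α β γ δ : ℂ), α • (b₁ (b₂ x) - f 0 (f 1 x)) + β • (b₂ (b₁ x) - f 1 (f 0 x))
      + γ • k 0 (ki 1 x) + δ • k 1 (ki 0 x) ∈ wordFiltration f v n := fun α β γ δ =>
    add_mem (add_mem (add_mem (Submodule.smul_mem _ _ h1) (Submodule.smul_mem _ _ h2))
      (Submodule.smul_mem _ _ h3)) (Submodule.smul_mem _ _ h4)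
  have e2 : ∀ η : ℂ, η • x ∈ wordFiltration f v n := fun η => Submodule.smul_mem _ _ hx
  convert add_mem (e1 (1 - a) (a * q - q⁻¹)
    (-(q⁻¹ * (q - q⁻¹)⁻¹ * ((q + q⁻¹) * c₂)) + a * (q - q⁻¹)⁻¹ * c₂)
    (q⁻¹ * (q - q⁻¹)⁻¹ * c₁ - a * (q - q⁻¹)⁻¹ * ((q + q⁻¹) * c₁)))
    (e2 ((q - q⁻¹)⁻¹ * (q * c₁ * κ⁻¹ * a ^ 2 + (q ^ 2)⁻¹ * c₂ * κ * a⁻¹))) using 1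
  module

/-- The leading term of a product of operators `opM`, applied to a highest weight vector, does
not depend on the parameters of the coideal subalgebra. -/
theorem prod_polyM_leading (h : IsRepr q e f k ki) (hq : q ≠ 0) (he : ∀ i, e i v = 0)
    (hk : ∀ i, k i v = q ^ l i • v) {φ ψ : MvPolynomial (Fin 2) ℂ →ₐ[ℂ] Module.End ℂ V}
    (hZ : φ (.X 0) = opZ q c₁ c₂ (f 0 - c₁ • (e 1 * ki 0)) (f 1 - c₂ • (e 0 * ki 1))
      (k 0 * ki 1) (k 1 * ki 0))
    (hY : φ (.X 1) = opY q c₁ c₂ (f 0 - c₁ • (e 1 * ki 0)) (f 1 - c₂ • (e 0 * ki 1))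
      (k 0 * ki 1) (k 1 * ki 0))
    (hZ₀ : ψ (.X 0) = opZ q 0 0 (f 0) (f 1) (k 0 * ki 1) (k 1 * ki 0))
    (hY₀ : ψ (.X 1) = opY q 0 0 (f 0) (f 1) (k 0 * ki 1) (k 1 * ki 0))
    {ι : Type*} (S : Finset ι) (a : ι → ℂ) :
    φ (∏ t ∈ S, polyM q c₁ c₂ κ (a t)) v - ψ (∏ t ∈ S, polyM q 0 0 κ (a t)) v
      ∈ wordFiltration f v (2 * S.card) ∧
    ψ (∏ t ∈ S, polyM q 0 0 κ (a t)) v ∈ wordFiltration f v (2 * S.card + 1) ∧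
    ψ (∏ t ∈ S, polyM q 0 0 κ (a t)) v ∈
      Module.End.eigenspace (k 0 * k 1) (q ^ ((l 0 : ℤ) + l 1 - (2 * S.card : ℕ))) := by
  classical
  induction S using Finset.induction_on with
  | empty =>
    refine ⟨by simp, by simpa using mem_wordFiltration_one, by simpa using v_mem_eigenspace hq hk⟩
  | insert t S ht ih =>
    obtain ⟨h1, h2, h3⟩ := ih
    rw [Finset.prod_insert ht, Finset.prod_insert ht, Finset.card_insert_of_notMem ht, map_mul,
      map_mul, Module.End.mul_apply, Module.End.mul_apply, map_polyM hZ hY, map_polyM hZ₀ hY₀,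
      opM_zero_apply]
    generalize φ (∏ t ∈ S, polyM q c₁ c₂ κ (a t)) v = x at *
    generalize ψ (∏ t ∈ S, polyM q 0 0 κ (a t)) v = y at *
    have hff : ∀ (i j : Fin 2) {n : ℕ} {x : V}, x ∈ wordFiltration f v n →
        f i (f j x) ∈ wordFiltration f v (n + 2) := fun i j n x hx =>
      f_mem_wordFiltration i (f_mem_wordFiltration j hx)
    refine ⟨?_, ?_, ?_⟩
    · have h4 := wordFiltration_mono (show 2 * S.card + 1 ≤ 2 * (S.card + 1) by omega)
        (h.opM_sub_mem (c₁ := c₁) (c₂ := c₂) (κ := κ) hq he hk rfl rfl (a t) h2)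
      have h5 := wordFiltration_mono (show 2 * S.card ≤ 2 * (S.card + 1) by omega)
        (h.opM_sub_mem (c₁ := c₁) (c₂ := c₂) (κ := κ) hq he hk rfl rfl (a t) h1)
      have h6 : ∀ i j, f i (f j (x - y)) ∈ wordFiltration f v (2 * (S.card + 1)) :=
        fun i j => hff i j h1
      have h7 := add_mem (add_mem h4 h5) (add_mem (Submodule.smul_mem _ (1 - a t) (h6 0 1))
        (Submodule.smul_mem _ (a t * q - q⁻¹) (h6 1 0)))
      convert h7 using 1
      simp only [map_sub]
      module
    · exact add_mem (Submodule.smul_mem _ _ (hff 0 1 h2)) (Submodule.smul_mem _ _ (hff 1 0 h2))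
    · have h8 : ∀ i j, f i (f j y) ∈ Module.End.eigenspace (k 0 * k 1)
          (q ^ ((l 0 : ℤ) + l 1 - (2 * (S.card + 1) : ℕ))) := by
        intro i j
        convert h.f_mem_eigenspace hq i (h.f_mem_eigenspace hq j h3) using 3
        push_cast; ring
      exact add_mem (Submodule.smul_mem _ _ (h8 0 1)) (Submodule.smul_mem _ _ (h8 1 0))

/-- The extremal vector of lowest weight is not zero. -/
theorem lowest_ne_zero [FiniteDimensional ℂ V] (h : IsRepr q e f k ki) (hq : q ≠ 0)
    (hD : q - q⁻¹ ≠ 0)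
    (hinj : Function.Injective fun t : ℤ => q ^ t) (hv : v ≠ 0) (he : ∀ i, e i v = 0)
    (hk : ∀ i, k i v = q ^ l i • v) :
    (f 1 ^ l 0) ((f 0 ^ l 0) ((f 0 ^ l 1) ((f 1 ^ l 1) v))) ≠ 0 := by
  have h01 : (0 : Fin 2) ≠ 1 := by decide
  have hne : ∀ (i : Fin 2) {N : ℕ} {u : V}, e i u = 0 → k i u = q ^ N • u → u ≠ 0 →
      ∀ j ≤ N, (f i ^ j) u ≠ 0 := fun i N u => pow_f_apply_ne_zero hq hD hinj (h.ki_mul_k i)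
    (h.k_f_same i) (h.ki_f_same hq i) (h.e_f_same i)
  have hzero : ∀ (i : Fin 2) {N : ℕ} {u : V}, e i u = 0 → k i u = q ^ N • u →
      (f i ^ (N + 1)) u = 0 := fun i N u => pow_f_apply_eq_zero hq hD hinj (h.ki_mul_k i)
    (h.k_f_same i) (h.ki_f_same hq i) (h.e_f_same i)
  have ap : ∀ {a b : Module.End ℂ V} {t : ℂ}, a * b = t • (b * a) → ∀ (n : ℕ) (x : V),
      a ((b ^ n) x) = t ^ n • (b ^ n) (a x) := fun hab n x =>
    LinearMap.congr_fun (mul_pow_of_mul_eq_smul hab n) x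
  have hef : ∀ i j, i ≠ j → ∀ (n : ℕ) (x : V), e i ((f j ^ n) x) = (f j ^ n) (e i x) :=
    fun i j hij n x => by
      simpa using ap (t := 1) (by rw [one_smul]; exact h.e_f_ne i j hij) n x
  have hk0 : ∀ n : ℕ, k 0 ((f 1 ^ n) v) = q ^ (l 0 + n) • (f 1 ^ n) v := fun n => by
    rw [ap (h.k_f_ne 0 1 h01), hk, map_smul, smul_smul]; congr 1; ring
  have he0 : ∀ n : ℕ, e 0 ((f 1 ^ n) v) = 0 := fun n => by
    rw [hef 0 1 h01, he, map_zero]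
  -- Three rank-one steps: `v` has weight `l 1` for index `1`, then `f 1 ^ l 1` applied to `v` has
  -- weight `l 0 + l 1` for index `0`, and the result is again a highest weight vector for index
  -- `1`, of weight `l 0`.
  rw [← Module.End.mul_apply (f 0 ^ l 0), ← pow_add]
  refine hne 1 ?_ ?_ (hne 0 (he0 _) (hk0 _) (hne 1 (he 1) (hk 1) hv _ le_rfl) _ le_rfl) _ le_rfl
  · rw [hef 1 0 h01.symm]
    rcases Nat.eq_zero_or_pos (l 1) with hl | hl
    · rw [hl, pow_zero, Module.End.one_apply, he, map_zero]
    · obtain ⟨n, hn⟩ := Nat.exists_eq_add_of_le' hl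
      -- `e 1` removes one `f 1`, which lowers the index-`0` weight to `l 0 + l 1 - 1`; then `f 0 ^
      -- (l 0 + l 1)` is one power too many.
      rw [hn, e_pow_f_apply hq hD (h.ki_mul_k 1) (h.k_f_same 1) (h.ki_f_same hq 1) (h.e_f_same 1)
        (he 1) (hk 1), map_smul, ← add_assoc, hzero 0 (he0 n) (hk0 n), smul_zero]
  · rw [ap (h.k_f_ne 1 0 h01.symm), ap (h.k_f_same 1), hk]
    simp only [map_smul, smul_smul]
    congr 1
    rw [pow_add, inv_pow, ← pow_mul, two_mul, pow_add]
    have := pow_ne_zero (l 1) hq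
    field_simp

end IsRepr
end Leading
-- Decomposition of the highest weight vector into strings.
section Decomposition

variable {V : Type*} [AddCommGroup V] [Module ℂ V] {q c₁ c₂ : ℂ}
  {e f k ki : Fin 2 → Module.End ℂ V} {v : V} {l : Fin 2 → ℕ}

theorem genericity (hq : q ≠ 0) (hc₁ : c₁ ≠ 0) {l₁ l₂ : ℕ}
    (hc : ∀ m : ℕ, c₂ * c₁⁻¹ ≠ -(q ^ (2 * (l₁ : ℤ) + 2 * (l₂ : ℤ) + 1 - (m : ℤ))))
    {t : ℤ} {r s : ℕ} (ht : t ≤ l₁) (hr : r ≤ l₁) :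
    q * c₁ * (q ^ ((l₁ : ℤ) - l₂))⁻¹ + (q ^ 2)⁻¹ * c₂ * q ^ ((l₁ : ℤ) - l₂)
      / (q ^ (2 * t) * q ^ (2 * (r : ℤ)) * q ^ (2 * (-(s : ℤ) - 1))) ≠ 0 := by
  intro h
  -- Solving for `c₂/c₁` gives `-q^(2l₁+2l₂+1-m)` with this `m`, which is nonnegative because `t, r
  -- ≤ l₁`.
  apply hc (4 * (l₁ : ℤ) - 2 * t - 2 * r + 2 * s).toNat
  rw [Int.toNat_of_nonneg (by omega)]
  have hz : ∀ n : ℤ, q ^ n ≠ 0 := fun n => zpow_ne_zero n hq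
  have e1 : q ^ (2 * (l₁ : ℤ) + 2 * (l₂ : ℤ) + 1 - (4 * (l₁ : ℤ) - 2 * t - 2 * r + 2 * s))
      = q ^ 3 * (q ^ ((l₁ : ℤ) - l₂))⁻¹ * (q ^ ((l₁ : ℤ) - l₂))⁻¹
        * (q ^ (2 * t) * q ^ (2 * (r : ℤ)) * q ^ (2 * (-(s : ℤ) - 1))) := by
    rw [← zpow_natCast q 3, ← zpow_neg, ← zpow_add₀ hq, ← zpow_add₀ hq, ← zpow_add₀ hq,
      ← zpow_add₀ hq, ← zpow_add₀ hq]
    congr 1; push_cast; ring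
  rw [e1]
  have h1 := mul_ne_zero (mul_ne_zero (hz (2 * t)) (hz (2 * (r : ℤ)))) (hz (2 * (-(s : ℤ) - 1)))
  have h2 := hz ((l₁ : ℤ) - l₂)
  generalize q ^ (2 * t) * q ^ (2 * (r : ℤ)) * q ^ (2 * (-(s : ℤ) - 1)) = x at *
  generalize q ^ ((l₁ : ℤ) - l₂) = κ at *
  field_simp at h ⊢
  linear_combination h

namespace IsRepr

/-- `E_j` commutes with `F_i` and kills `v`, so the second term of the coideal generator never
contributes. -/
theorem pow_coideal_apply (h : IsRepr q e f k ki) (hq : q ≠ 0) (he : ∀ i, e i v = 0)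
    (hk : ∀ i, k i v = q ^ l i • v) (c : ℂ) {i j : Fin 2} (hij : i ≠ j) (n : ℕ) :
    ((f i - c • (e j * ki i)) ^ n) v = (f i ^ n) v := by
  induction n with
  | zero => simp
  | succ n ih =>
    have ap : ∀ {a b : Module.End ℂ V} {t : ℂ}, a * b = t • (b * a) → ∀ (n : ℕ) (x : V),
      a ((b ^ n) x) = t ^ n • (b ^ n) (a x) := fun hab n x =>
        LinearMap.congr_fun (mul_pow_of_mul_eq_smul hab n) x
    have h1 : e j ((f i ^ n) v) = 0 := by
      rw [ap (t := 1) (by rw [one_smul]; exact h.e_f_ne j i hij.symm), he, map_zero, smul_zero]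
    have h2 : e j (ki i ((f i ^ n) v)) = 0 := by
      rw [ap (h.ki_f_same hq i), h.ki_v hq hk]
      simp only [map_smul, h1, smul_zero]
    rw [pow_succ', Module.End.mul_apply, ih, pow_succ', Module.End.mul_apply,
      LinearMap.sub_apply, LinearMap.smul_apply, Module.End.mul_apply, h2, smul_zero, sub_zero]

/-- A finite-dimensional highest weight module is, as far as the highest weight vector is
concerned, a sum of strings for the coideal subalgebra. -/
theorem exists_strings [FiniteDimensional ℂ V] (h : IsRepr q e f k ki) (hq : q ≠ 0)
    (hD : q - q⁻¹ ≠ 0) (hinj : Function.Injective fun t : ℤ => q ^ t) (hc₁ : c₁ ≠ 0)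
    (hc : ∀ m : ℕ, c₂ * c₁⁻¹ ≠ -(q ^ (2 * (l 0 : ℤ) + 2 * (l 1 : ℤ) + 1 - (m : ℤ))))
    (hv : v ≠ 0) (he : ∀ i, e i v = 0) (hk : ∀ i, k i v = q ^ l i • v) :
    ∃ w : Fin (l 0 + 1) × Fin (l 1 + 1) → ℕ → V,
      (∀ p, IsString q (q ^ ((l 0 : ℤ) - l 1 - 3 * ((p.1 : ℕ) : ℤ))) (f 0 - c₁ • (e 1 * ki 0))
        (f 1 - c₂ • (e 0 * ki 1)) (k 0 * ki 1) (p.1 + p.2) (w p)) ∧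
      v ∈ ⨆ p, IsString.toSubmodule (w p) (p.1 + p.2) := by
  have hb := h.isCoidealRepr hq hD c₁ c₂
  have hf : IsCoidealRepr q 0 0 (f 0) (f 1) (k 0 * ki 1) (k 1 * ki 0) := by
    simpa using h.isCoidealRepr hq hD 0 0
  have hb₁ := h.pow_coideal_apply hq he hk c₁ (i := 0) (j := 1) (by decide) (l 0 + 1)
  have hb₂ := h.pow_coideal_apply hq he hk c₂ (i := 1) (j := 0) (by decide) (l 1 + 1)
  obtain ⟨φ, hZ, hY⟩ := exists_algHom_of_commute (hb.opZ_comm_opY hq hD)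
  obtain ⟨ψ, hZ₀, hY₀⟩ := exists_algHom_of_commute (hf.opZ_comm_opY hq hD)
  obtain ⟨κ, hκ⟩ : ∃ κ : ℂ, κ = q ^ ((l 0 : ℤ) - l 1) := ⟨_, rfl⟩
  have hκ0 : κ ≠ 0 := hκ ▸ zpow_ne_zero _ hq
  have hkv : (k 0 * ki 1) v = κ • v := by
    rw [Module.End.mul_apply, h.ki_v hq hk, map_smul, hk, smul_smul, hκ, zpow_sub₀ hq,
      zpow_natCast, zpow_natCast, div_eq_mul_inv, mul_comm]
  have hzero : ∀ i, (f i ^ (l i + 1)) v = 0 := fun i => pow_f_apply_eq_zero hq hD hinj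
    (h.ki_mul_k i) (h.k_f_same i) (h.ki_f_same hq i) (h.e_f_same i) (he i) (hk i)
  rw [hzero] at hb₁ hb₂
  have hlead := fun (S : Finset (ℕ ⊕ ℕ)) a =>
    h.prod_polyM_leading (κ := κ) hq he hk hZ hY hZ₀ hY₀ S a
  -- the nodes of the two families of lines
  set A : ℕ → MvPolynomial (Fin 2) ℂ := fun t => polyM q c₁ c₂ κ (q ^ (2 * (t : ℤ))) with hA
  set B : ℕ → MvPolynomial (Fin 2) ℂ := fun t => polyM q c₁ c₂ κ (q ^ (2 * (-(t : ℤ) - 1)))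
    with hB
  set A₀ : ℕ → MvPolynomial (Fin 2) ℂ := fun t => polyM q 0 0 κ (q ^ (2 * (t : ℤ))) with hA₀
  set B₀ : ℕ → MvPolynomial (Fin 2) ℂ := fun t => polyM q 0 0 κ (q ^ (2 * (-(t : ℤ) - 1)))
    with hB₀
  have hz : ∀ n : ℤ, q ^ n ≠ 0 := fun n => zpow_ne_zero n hq
  have hzne : ∀ {m n : ℤ}, m ≠ n → q ^ m ≠ q ^ n := fun hmn h => hmn (hinj h)
  have hprod : ∀ {x : V} {c : ℂ}, c ≠ 0 → ∀ {y : V}, y = c • x → y = 0 → x = 0 :=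
    fun hc _ hy hy0 => (smul_eq_zero.1 (hy.symm.trans hy0)).resolve_left hc
  have hAv : φ (∏ t ∈ Finset.range (l 0 + 1), A t) v = 0 := by
    obtain ⟨c, hc, h1⟩ := hb.pow_b₂_pow_b₁ hq hD hκ0 hZ hY hkv (l 0 + 1)
    exact hprod hc h1 (by rw [hb₁, map_zero])
  have hBv : φ (∏ t ∈ Finset.range (l 1 + 1), B t) v = 0 := by
    obtain ⟨c, hc, h1⟩ := hb.pow_b₁_pow_b₂ hq hD hκ0 hZ hY hkv (l 1 + 1)
    exact hprod hc h1 (by rw [hb₂, map_zero])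
  have hAv₀ : ψ (∏ t ∈ Finset.range (l 0 + 1), A₀ t) v = 0 := by
    obtain ⟨c, hc, h1⟩ := hf.pow_b₂_pow_b₁ hq hD hκ0 hZ₀ hY₀ hkv (l 0 + 1)
    exact hprod hc h1 (by rw [hzero, map_zero])
  have hBv₀ : ψ (∏ t ∈ Finset.range (l 1 + 1), B₀ t) v = 0 := by
    obtain ⟨c, hc, h1⟩ := hf.pow_b₁_pow_b₂ hq hD hκ0 hZ₀ hY₀ hkv (l 1 + 1)
    exact hprod hc h1 (by rw [hzero, map_zero])
  -- The product with the last line of each family omitted is, up to scalars, the lowest weight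
  -- vector.
  have hlow : ψ ((∏ t ∈ Finset.range (l 0), A₀ t) * ∏ t ∈ Finset.range (l 1), B₀ t) v ≠ 0 := by
    intro h0
    obtain ⟨c, -, h1⟩ := hf.pow_b₁_pow_b₂ hq hD hκ0 hZ₀ hY₀ hkv (l 1)
    obtain ⟨c', -, h2⟩ := hf.pow_b₂_pow_b₁ hq hD hκ0 hZ₀ hY₀
      (hf.k_map_apply hq hZ₀ hY₀ (∏ t ∈ Finset.range (l 1), B₀ t) hkv) (l 0)
    apply h.lowest_ne_zero hq hD hinj hv he hk
    rw [h1, map_smul, map_smul, h2, ← Module.End.mul_apply, ← map_mul, h0, smul_zero, smul_zero]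
  have hnode : ∀ (r s : ℕ), q ^ (2 * (r : ℤ)) ≠ q ^ (2 * (-(s : ℤ) - 1)) := fun r s =>
    hzne (by omega)
  have hinterp₀ : ∀ (r s : ℕ) (t : ℤ), ∃ μ ν : ℂ,
      polyM q 0 0 κ (q ^ (2 * t)) = μ • A₀ r + ν • B₀ s := fun r s t =>
    ⟨_, _, (polyM_interpolate q 0 0 κ (hz _) (hz _) (hz _) (hnode r s)).trans (by simp; rfl)⟩
  have hne₀ : ∀ r s, r ≤ l 0 → s ≤ l 1 → ψ (omitProd A₀ B₀ (l 0) (l 1) r s) v ≠ 0 :=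
    fun r s hr hs => omitProd_ne_zero hAv₀ hBv₀ (fun r r' s => hinterp₀ r s r')
      (fun s s' r => by
        obtain ⟨μ, ν, h⟩ := hinterp₀ r s (-(s' : ℤ) - 1)
        exact ⟨ν, μ, h.trans (add_comm _ _)⟩) hlow hr hs
  -- If the vector vanished, its leading term, computed at zero parameters, would be a combination
  -- of shorter words and hence zero by weight.
  have hne : ∀ r s, r ≤ l 0 → s ≤ l 1 → φ (omitProd A B (l 0) (l 1) r s) v ≠ 0 := by
    intro r s hr hs h0
    apply hne₀ r s hr hs
    obtain ⟨h1, -, h3⟩ := hlead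
      (((Finset.range (l 0 + 1)).erase r).disjSum ((Finset.range (l 1 + 1)).erase s))
      (Sum.elim (fun t => q ^ (2 * (t : ℤ))) fun t => q ^ (2 * (-(t : ℤ) - 1)))
    rw [Finset.prod_disjSum, Finset.prod_disjSum] at h1
    rw [Finset.prod_disjSum] at h3
    refine h.eq_zero_of_mem_wordFiltration hq hinj hk ?_ h3
    have h4 := neg_mem h1
    rw [neg_sub] at h4
    simp only [Sum.elim_inl, Sum.elim_inr] at h4
    rw [omitProd] at h0
    rw [hA, hB] at h0
    rw [h0, sub_zero] at h4
    exact h4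
  have hinterp : ∀ (r s : ℕ) (t : ℤ), r ≤ l 0 → t ≤ l 0 → ∃ α β γ : ℂ,
      polyM q c₁ c₂ κ (q ^ (2 * t)) = α • A r + β • B s + γ • 1 ∧
        (t ≠ r → t ≠ -(s : ℤ) - 1 → γ ≠ 0) := fun r s t hr ht =>
    ⟨_, _, _, polyM_interpolate q c₁ c₂ κ (hz _) (hz _) (hz _) (hnode r s), fun h1 h2 =>
      mul_ne_zero (mul_ne_zero (inv_ne_zero hD) (mul_ne_zero (sub_ne_zero.2 (hzne (by omega)))
        (sub_ne_zero.2 (hzne (by omega))))) (hκ ▸ genericity hq hc₁ hc ht hr)⟩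
  have hspan := mem_span_omitProd hAv hBv
    (fun r s t hr _ ht => by
      obtain ⟨α, β, γ, h, hγ⟩ := hinterp r s t hr (by omega)
      exact ⟨α, β, γ, h, fun htr => hγ (by omega) (by omega)⟩)
    (fun r s t hr _ _ => by
      obtain ⟨α, β, γ, h, hγ⟩ := hinterp r s (-(t : ℤ) - 1) hr (by omega)
      exact ⟨α, β, γ, h, fun hts => hγ (by omega) (by omega)⟩) hne
  have hstr : ∀ p : Fin (l 0 + 1) × Fin (l 1 + 1), _ := fun p =>
    hb.isString hq hD hκ0 hZ hY (hb.k_map_apply hq hZ hY (omitProd A B (l 0) (l 1) p.1 p.2) hkv)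
      (hne p.1 p.2 (Nat.lt_succ_iff.1 p.1.2) (Nat.lt_succ_iff.1 p.2.2)) (r := p.1) (s := p.2)
      (l₁ := l 0) (l₂ := l 1)
      (fun t _ ht h1 h2 => by
        obtain ⟨α, β, γ, h3, hγ⟩ := hinterp p.1 p.2 t (Nat.lt_succ_iff.1 p.1.2) ht
        refine ⟨γ, hγ h1 h2, ?_⟩
        rw [← map_polyM rfl rfl, h3, map_add, map_add, map_smul, map_smul, map_smul, map_one]
        simp only [LinearMap.add_apply, LinearMap.smul_apply, Module.End.one_apply,
          apply_omitProd_left hAv (Nat.lt_succ_iff.1 p.1.2),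
          apply_omitProd_right hBv (Nat.lt_succ_iff.1 p.2.2), smul_zero, zero_add])
      (Nat.lt_succ_iff.1 p.1.2) (Nat.lt_succ_iff.1 p.2.2)
      ((hb.pow_b₁_map_apply hq hD hZ hY _).1 hb₁) ((hb.pow_b₁_map_apply hq hD hZ hY _).2 hb₂)
  refine ⟨fun p j => ((f 1 - c₂ • (e 0 * ki 1)) ^ j) (((f 0 - c₁ • (e 1 * ki 0)) ^ (p.1 : ℕ))
    (φ (omitProd A B (l 0) (l 1) p.1 p.2) v)), fun p => ?_, ?_⟩
  · have := (hstr p).1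
    rw [hκ, ← zpow_add₀ hq] at this
    convert this using 2
    ring
  · refine Submodule.span_le.2 ?_ hspan
    rintro _ ⟨p, rfl⟩
    refine Submodule.mem_iSup_of_mem p ?_
    obtain ⟨h1, c, hc, h2⟩ := hstr p
    have h3 := Submodule.smul_mem _ c⁻¹ (h1.mem_toSubmodule p.1)
    rw [h2, smul_smul, inv_mul_cancel₀ hc, one_smul] at h3
    exact h3

end IsRepr
end Decomposition
-- From strings of operators to modules over the coideal subalgebra.
-- A simple submodule that meets the sum of the others lies in it, and is then isomorphic to one of
-- them.
theorem iSupIndep_of_isSimpleModule {R M ι : Type*} [Ring R] [AddCommGroup M] [Module R M]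
    (W : ι → Submodule R M) (hs : ∀ i, IsSimpleModule R (W i))
    (hW : ∀ i j, i ≠ j → IsEmpty (W i ≃ₗ[R] W j)) : iSupIndep W := by
  intro i
  refine (IsAtom.not_le_iff_disjoint (isSimpleModule_iff_isAtom.1 (hs i))).1 ?_
  intro hle
  have e : (⨆ j, ⨆ (_ : j ≠ i), W j) = sSup (W '' {j | j ≠ i}) := by rw [sSup_image]; rfl
  rw [e] at hle
  have hs' : ∀ m : (W '' {j | j ≠ i} : Set (Submodule R M)), IsSimpleModule R m := by
    rintro ⟨_, j, -, rfl⟩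
    exact hs j
  obtain ⟨_, ⟨j, hj, rfl⟩, ⟨g⟩⟩ := Submodule.linearEquiv_of_le_sSup (W i) _ hle
  exact (hW i j (Ne.symm hj)).false g

section Coideal

variable {q c₁ c₂ : ℂ} {V : Type*} [AddCommGroup V] [Module ℂ V] [Module (Uq q) V]
  [IsScalarTower ℂ (Uq q) V]

/-- The action of `U_q(su(3))` on a module. -/
noncomputable def action (q : ℂ) (V : Type*) [AddCommGroup V] [Module ℂ V] [Module (Uq q) V]
    [IsScalarTower ℂ (Uq q) V] : Uq q →ₐ[ℂ] Module.End ℂ V :=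
  Algebra.lsmul ℂ ℂ V

theorem isRepr_action : IsRepr q (fun i => action q V (E q i)) (fun i => action q V (F q i))
    (fun i => action q V (K q i)) (fun i => action q V (Kinv q i)) :=
  (isRepr_gen q).map (action q V)

/-- `B₂` as an element of `𝓑`. -/
noncomputable def coidealB₂ (q c₁ c₂ : ℂ) : coideal q c₁ c₂ :=
  ⟨elemB₂ q c₂, Algebra.subset_adjoin (by simp)⟩

/-- A subspace that is stable under the generators of the coideal subalgebra, as a module. -/
def coidealSubmodule (S : Submodule ℂ V) (hK : ∀ x ∈ S, elemK q • x ∈ S)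
    (hKi : ∀ x ∈ S, elemKinv q • x ∈ S) (h₁ : ∀ x ∈ S, elemB₁ q c₁ • x ∈ S)
    (h₂ : ∀ x ∈ S, elemB₂ q c₂ • x ∈ S) : Submodule (coideal q c₁ c₂) V :=
  { S with
    smul_mem' := by
      rintro ⟨a, ha⟩ x hx
      change a • x ∈ S
      change x ∈ S at hx
      revert x
      induction ha using Algebra.adjoin_induction with
      | mem a ha =>
        intro x hx
        rcases ha with rfl | rfl | rfl | rfl
        exacts [hK x hx, hKi x hx, h₁ x hx, h₂ x hx]
      | algebraMap r => intro x hx; rw [algebraMap_smul]; exact S.smul_mem r hx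
      | add a b _ _ ha hb => intro x hx; rw [add_smul]; exact S.add_mem (ha hx) (hb hx)
      | mul a b _ _ ha hb => intro x hx; rw [mul_smul]; exact ha (hb hx) }

theorem isIrrep_of_isString {μ : ℂ} {n : ℕ} {w : ℕ → V} {W : Submodule (coideal q c₁ c₂) V}
    (h : IsString q μ (action q V (elemB₁ q c₁)) (action q V (elemB₂ q c₂))
      (action q V (elemK q)) n w) (hμ : μ ≠ 0) (hq : Function.Injective fun t : ℤ => q ^ t)
    (hW : ∀ x, x ∈ W ↔ x ∈ IsString.toSubmodule w n) : IsIrrep q c₁ c₂ μ n W where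
  simple := by
    rw [isSimpleModule_iff_isAtom]
    refine ⟨fun h0 => h.ne_zero ?_, fun S hS => by_contra fun hS0 => hS.ne ?_⟩
    · have := (hW _).2 (h.mem_toSubmodule 0)
      rwa [h0, Submodule.mem_bot] at this
    · have key := h.eq_of_stable hμ hq (S := S.restrictScalars ℂ)
        (fun x hx => (hW x).1 (hS.le hx)) (fun h0 => hS0 ?_)
        (fun x hx => S.smul_mem (coidealB₁ q c₁ c₂) hx)
        (fun x hx => S.smul_mem (coidealB₂ q c₁ c₂) hx)
      · ext x
        rw [hW x, ← key]
        rfl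
      · rwa [Submodule.restrictScalars_eq_bot_iff] at h0
  finrank_eq := by
    have e : W.restrictScalars ℂ = IsString.toSubmodule w n := Submodule.ext hW
    rw [← h.finrank_toSubmodule hμ hq, ← e]
    rfl
  highestWeight := by
    refine ⟨⟨⟨w 0, (hW _).2 (h.mem_toSubmodule 0)⟩, ?_, ?_, ?_⟩, ?_⟩
    · exact fun h0 => h.ne_zero (congrArg Subtype.val h0)
    · exact Subtype.ext h.b₁_zero
    · refine Subtype.ext ((h.k_apply 0).trans ?_)
      simp
    · rintro ⟨x, hx⟩ h0
      exact Subtype.ext (h.eq_zero_of_k_apply hμ hq ((hW x).1 hx) (congrArg Subtype.val h0))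

/-- The dimension determines `n`; the eigenvalue of `K` on the kernel of `B₁`, which is a line,
determines `μ`. -/
theorem eq_of_linearEquiv {μ μ' : ℂ} {n n' : ℕ} {w w' : ℕ → V}
    {W W' : Submodule (coideal q c₁ c₂) V}
    (h : IsString q μ (action q V (elemB₁ q c₁)) (action q V (elemB₂ q c₂))
      (action q V (elemK q)) n w)
    (h' : IsString q μ' (action q V (elemB₁ q c₁)) (action q V (elemB₂ q c₂))
      (action q V (elemK q)) n' w') (hμ : μ ≠ 0) (hμ' : μ' ≠ 0)
    (hq : Function.Injective fun t : ℤ => q ^ t)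
    (hW : ∀ x, x ∈ W ↔ x ∈ IsString.toSubmodule w n)
    (hW' : ∀ x, x ∈ W' ↔ x ∈ IsString.toSubmodule w' n')
    (g : W ≃ₗ[coideal q c₁ c₂] W') : μ = μ' ∧ n = n' := by
  have hn : n + 1 = n' + 1 := by
    rw [← (isIrrep_of_isString h hμ hq hW).finrank_eq,
      ← (isIrrep_of_isString h' hμ' hq hW').finrank_eq]
    exact (g.restrictScalars ℂ).finrank_eq
  refine ⟨?_, by omega⟩
  obtain ⟨⟨x, hx0, hx₁, hxK⟩, -⟩ := (isIrrep_of_isString h hμ hq hW).highestWeight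
  have h1 : coidealB₁ q c₁ c₂ • g x = 0 := by rw [← map_smul, hx₁, map_zero]
  have h2 : coidealK q c₁ c₂ • g x = μ • g x := by
    rw [← map_smul, hxK]; exact (g.restrictScalars ℂ).map_smul μ x
  have h3 : (g x : V) ≠ 0 := fun h0 => hx0 (g.map_eq_zero_iff.1 (Subtype.ext h0))
  obtain ⟨c, hc⟩ := h'.exists_smul_of_b₁_eq_zero hμ' hq ((hW' _).1 (g x).2)
    (congrArg Subtype.val h1)
  have h4 : action q V (elemK q) (g x : V) = μ • (g x : V) := congrArg Subtype.val h2
  have h5 : action q V (elemK q) (g x : V) = μ' • (g x : V) := by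
    rw [hc, map_smul, h'.k_apply, smul_comm]; simp
  exact smul_left_injective ℂ h3 (h4.symm.trans h5)

theorem eq_top_of_stable [IsSimpleModule (Uq q) V] {S : Submodule ℂ V} (hS : S ≠ ⊥)
    (h : ∀ x ∈ S, ∀ i, E q i • x ∈ S ∧ F q i • x ∈ S ∧ K q i • x ∈ S ∧ Kinv q i • x ∈ S) :
    S = ⊤ := by
  have hmk : ∀ (a : FreeAlgebra ℂ Gen), ∀ x ∈ S, Uq.mk q a • x ∈ S := by
    intro a
    induction a using FreeAlgebra.induction with
    | grade0 r =>
      intro x hx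
      rw [AlgHom.commutes, algebraMap_smul]
      exact S.smul_mem r hx
    | grade1 g =>
      intro x hx
      cases g with
      | E i => exact (h x hx i).1
      | F i => exact (h x hx i).2.1
      | K i => exact (h x hx i).2.2.1
      | Kinv i => exact (h x hx i).2.2.2
    | mul a b ha hb => intro x hx; rw [map_mul, mul_smul]; exact ha _ (hb x hx)
    | add a b ha hb => intro x hx; rw [map_add, add_smul]; exact S.add_mem (ha x hx) (hb x hx)
  let S' : Submodule (Uq q) V :=
    { S with
      smul_mem' := by
        intro a x hx
        obtain ⟨a, rfl⟩ := RingQuot.mkAlgHom_surjective ℂ (Rel q) a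
        exact hmk a x hx }
  have hS' : S' = ⊤ := by
    refine (eq_bot_or_eq_top S').resolve_left fun h0 => hS ?_
    ext x
    have : x ∈ S' ↔ x ∈ (⊥ : Submodule (Uq q) V) := by rw [h0]
    exact this.trans (by simp)
  ext x
  have : x ∈ S' ↔ x ∈ (⊤ : Submodule (Uq q) V) := by rw [hS']
  exact this.trans (by simp)

end Coideal

end QuantumSU3

/-! ### The decomposition theorem. -/

open QuantumSU3 in
theorem theorem4p1 (q : ℝ) (hq₀ : 0 < q) (hq₁ : q < 1)
    (c₁ c₂ : ℂ) (hc₁ : c₁ ≠ 0) (hc₂ : c₂ ≠ 0) (l₁ l₂ : ℕ)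
    (hc : ∀ m : ℕ, c₂ * c₁⁻¹ ≠ -((q : ℂ) ^ (2 * (l₁ : ℤ) + 2 * (l₂ : ℤ) + 1 - (m : ℤ))))
    (V : Type*) [AddCommGroup V] [Module ℂ V] [Module (QuantumSU3.Uq (q : ℂ)) V]
    [IsScalarTower ℂ (QuantumSU3.Uq (q : ℂ)) V] [FiniteDimensional ℂ V]
    [IsSimpleModule (QuantumSU3.Uq (q : ℂ)) V]
    (v : V) (hv : QuantumSU3.IsHighestWeightVector (q : ℂ) ![l₁, l₂] v) :
    ∃ W : Fin (l₁ + 1) × Fin (l₂ + 1) → Submodule (QuantumSU3.coideal (q : ℂ) c₁ c₂) V,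
      DirectSum.IsInternal W ∧
      (∀ p, QuantumSU3.IsIrrep (q : ℂ) c₁ c₂
        ((q : ℂ) ^ ((l₁ : ℤ) - (l₂ : ℤ) - 3 * ((p.1 : ℕ) : ℤ)))
        ((p.1 : ℕ) + (p.2 : ℕ)) (W p)) ∧
      (∀ p p', p ≠ p' → IsEmpty (W p ≃ₗ[QuantumSU3.coideal (q : ℂ) c₁ c₂] W p')) := by
  have hq : (q : ℂ) ≠ 0 := by exact_mod_cast hq₀.ne'
  have hinj : Function.Injective fun t : ℤ => (q : ℂ) ^ t := by
    intro a b hab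
    have : q ^ a = q ^ b := by
      simp only at hab
      exact_mod_cast hab
    exact zpow_right_injective₀ hq₀ hq₁.ne this
  have hD : (q : ℂ) - (q : ℂ)⁻¹ ≠ 0 := by
    rw [sub_ne_zero]
    intro h
    have := hinj (a₁ := 1) (a₂ := -1) (by simpa using h)
    omega
  have hr : IsRepr (q : ℂ) _ _ _ _ := isRepr_action (V := V)
  have hk : ∀ i, action (q : ℂ) V (K (q : ℂ) i) v = (q : ℂ) ^ (![l₁, l₂] i) • v := hv.K_smul
  have he : ∀ i, action (q : ℂ) V (E (q : ℂ) i) v = 0 := hv.E_smul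
  have e₁ : action (q : ℂ) V (F q 0) - c₁ • (action (q : ℂ) V (E q 1) * action q V (Kinv q 0))
      = action (q : ℂ) V (elemB₁ q c₁) := by
    rw [elemB₁, map_sub, map_smul, map_mul]
  have e₂ : action (q : ℂ) V (F q 1) - c₂ • (action (q : ℂ) V (E q 0) * action q V (Kinv q 1))
      = action (q : ℂ) V (elemB₂ q c₂) := by
    rw [elemB₂, map_sub, map_smul, map_mul]
  have e₃ : action (q : ℂ) V (K q 0) * action (q : ℂ) V (Kinv q 1)
      = action (q : ℂ) V (elemK q) := by rw [elemK, map_mul]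
  have e₄ : action (q : ℂ) V (K q 1) * action (q : ℂ) V (Kinv q 0)
      = action (q : ℂ) V (elemKinv q) := by rw [elemKinv, map_mul]
  have hb := hr.isCoidealRepr hq hD c₁ c₂
  obtain ⟨w, hw, hvw⟩ := hr.exists_strings (l := ![l₁, l₂]) (c₂ := c₂) hq hD hinj hc₁ hc
    hv.ne_zero he hk
  simp only [e₁, e₂, e₃, e₄] at hb hw
  have hμ : ∀ t : ℤ, (q : ℂ) ^ t ≠ 0 := fun t => zpow_ne_zero t hq
  let W : Fin (l₁ + 1) × Fin (l₂ + 1) → Submodule (coideal (q : ℂ) c₁ c₂) V := fun p =>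
    coidealSubmodule (IsString.toSubmodule (w p) (p.1 + p.2)) (hw p).stable_k
      (IsString.stable fun j _ => by
        rw [hb.ki_apply (mul_ne_zero (hμ _) (hμ _)) ((hw p).k_apply j)]
        exact Submodule.smul_mem _ _ ((hw p).mem_toSubmodule j))
      (hw p).stable_b₁ (hw p).stable_b₂
  have hW : ∀ p x, x ∈ W p ↔ x ∈ IsString.toSubmodule (w p) (p.1 + p.2) := fun p x => Iff.rfl
  have hirr : ∀ p, IsIrrep (q : ℂ) c₁ c₂ ((q : ℂ) ^ ((l₁ : ℤ) - (l₂ : ℤ) - 3 * ((p.1 : ℕ) : ℤ)))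
      ((p.1 : ℕ) + (p.2 : ℕ)) (W p) := fun p => isIrrep_of_isString (hw p) (hμ _) hinj (hW p)
  have hiso : ∀ p p', p ≠ p' → IsEmpty (W p ≃ₗ[coideal (q : ℂ) c₁ c₂] W p') := by
    refine fun p p' hpp => ⟨fun g => hpp ?_⟩
    obtain ⟨h1, h2⟩ := eq_of_linearEquiv (hw p) (hw p') (hμ _) (hμ _) hinj (hW p) (hW p') g
    -- Equal highest weights give equal first indices `i`; equal dimensions `i + x + 1` then give
    -- equal `x`.
    have h3 := hinj h1
    ext <;> omega
  refine ⟨W, ?_, hirr, hiso⟩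
  rw [DirectSum.isInternal_submodule_iff_iSupIndep_and_iSup_eq_top]
  refine ⟨iSupIndep_of_isSimpleModule W (fun p => (hirr p).simple) hiso, ?_⟩
  have hv' : v ∈ (⨆ p, W p).restrictScalars ℂ := by
    refine (iSup_le fun p x hx => ?_ :
      (⨆ p, IsString.toSubmodule (w p) (p.1 + p.2)) ≤ (⨆ p, W p).restrictScalars ℂ) hvw
    exact Submodule.mem_iSup_of_mem p ((hW p x).2 hx)
  have hfil := hr.wordFiltration_le_of_coideal_stable (c₁ := c₁) (c₂ := c₂) hq he hk hv'
    (fun x hx => by rw [e₁]; exact (⨆ p, W p).smul_mem (coidealB₁ q c₁ c₂) hx)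
    (fun x hx => by rw [e₂]; exact (⨆ p, W p).smul_mem (coidealB₂ q c₁ c₂) hx)
  -- The words in the `F_i` applied to `v` span a nonzero subspace stable under all generators,
  -- hence everything by irreducibility.
  have htop : (⨆ n, wordFiltration (fun i => action (q : ℂ) V (F q i)) v n) = ⊤ := by
    refine eq_top_of_stable (q := (q : ℂ)) (fun h0 => hv.ne_zero ?_) fun x hx i =>
      hr.iSup_wordFiltration_stable hq he hk hx i
    rw [← Submodule.mem_bot ℂ, ← h0]
    exact Submodule.mem_iSup_of_mem 1 mem_wordFiltration_one
  rw [eq_top_iff]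
  intro x _
  have hx : x ∈ ⨆ n, wordFiltration (fun i => action (q : ℂ) V (F q i)) v n := by
    rw [htop]; trivial
  exact (iSup_le hfil : (⨆ n, wordFiltration (fun i => action (q : ℂ) V (F q i)) v n)
    ≤ (⨆ p, W p).restrictScalars ℂ) hx
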